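/- **Setting.** Let $n\le p$, $p\ge 1$. Consider the ordinary differential equation $F(x,y,y^{(1)},\dots,y^{(n)})=0$, where $F$ is smooth on an open set $\Omega$ of $n$-jets and $dF\neq 0$ wherever $F=0$. Consider a grid $x_1,\dots,x_N$ with grid function $u_1,\dots,u_N$ ($N\ge 1$), step sizes $h=(h_1,\dots,h_{N-1})$ ranging over an open cone $H\subset\mathbb R^{N-1}$ (closed under multiplication by positive numbers), and difference equations $L_\alpha(x_1,\dots,x_N,u_1,\dots,u_N)=0$, $\alpha=1,\dots,N$. Put $h_{\beta,\alpha}=\sum_{i=\alpha}^{\beta-1}h_i$ for $\beta\ge\alpha$ and $h_{\beta,\alpha}=-h_{\alpha,\beta}$ for $\beta<\alpha$. Suppose that the difference equations approximate $F=0$ with first differential approximation $F+\varepsilon L^{(1)}_\alpha$ at each node, i.e. substituting $x_\beta=x_\alpha+\varepsilon h_{\beta,\alpha}$ and $u_\beta=\sum_{k=0}^{p}\frac{(\varepsilon h_{\beta,\alpha})^k}{k!}u_\alpha^{(k)}$ for all $\beta$ gives $$L_\alpha = F(x_\alpha,u_\alpha^{(0)},\dots,u_\alpha^{(n)})+\varepsilon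 L_\alpha^{(1)}(x_\alpha,u_\alpha^{(0)},\dots,u_\alpha^{(p)},h)+o(\varepsilon)\quad(\varepsilon\to0^+)$$ for all $x_\alpha,u_\alpha^{(0)},\dots,u_\alpha^{(p)}$ with $(x_\alpha,\dots,u_\alpha^{(n)})\in\Omega$ and all $h\in H$, with $L^{(1)}_\alpha$ smooth there. Let $D=\partial_x+y^{(1)}\partial_y+y^{(2)}\partial_{y^{(1)}}+\cdots$. A point operator $X_k=\xi_k(x,y)\partial_x+\varphi_k(x,y)\partial_y$, smooth on an open set $B$ of the $(x,y)$-plane that contains the projection of $\Omega$, is prolonged to derivatives by $\varphi_k^{(0)}=\varphi_k$, $\varphi_k^{(i)}=D\varphi_k^{(i-1)}-y^{(i)}D\xi_k$. For two such operators $X_0,X_1$, the operator $X_0^{\Delta}+\varepsilon X_1^{\Delta}$ acts on the discrete variables $x_\alpha,\ u_\alpha=u_\alpha^{(0)},u_\alpha^{(1)},\dots,u_\alpha^{(2p)},\ h_\alpha$ through this prolongation at every node and through $$\sigma_{0,\alpha}=h_\alpha D\xi_0,\qquad \sigma_{1,\alpha}=h_\alpha D\xi_1+\tfrac{h_\alpha^2}{2}D^2\xi_0$$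 (evaluated at node $\alpha$) on the step sizes. The approximate one-parameter group with this operator is the local group $z\mapsto f_0(z,a)+\varepsilon f_1(z,a)+o(\varepsilon)$ determined by $\partial_a f_0=X_0^\Delta(f_0)$, $\partial_a f_1=X_1^\Delta(f_0)+(X_0^\Delta)'(f_0)f_1$, $f_0|_{a=0}=z$, $f_1|_{a=0}=0$. It leaves a system $G(z,\varepsilon)=o(\varepsilon)$ invariant if it maps every $z=z_0+\varepsilon z_1+o(\varepsilon)$ satisfying the system to one satisfying it. **Stability.** The operator $X_0$ is *stable* with respect to the approximation if there is a smooth point operator $X_1=\xi_1(x,y)\partial_x+\varphi_1(x,y)\partial_y$ on $B$ such that, for every node $\alpha$, the approximate one-parameter group with operator $X_0^\Delta+\varepsilon X_1^\Delta+o(\varepsilon)$ leaves invariant the discrete system at the node $\alpha$, which consists of the equation $$F(x_\alpha,u_\alpha^{(0)},\dots,u_\alpha^{(n)})+\varepsilon L^{(1)}_\alpha(x_\alpha,u_\alpha^{(0)},\dots,u_\alpha^{(p)},h)=o(\varepsilon)$$ together with all grid relations $x_{i+1}-x_i-\varepsilon h_i=o(\varepsilon)$ and $u^{(J)}_{i+1}-u^{(J)}_i-\varepsilon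 h_i u_i^{(J+1)}=o(\varepsilon)$ for $1\le i\le N-1$, $0\le J\le p$. **Theorem.** Let $X_0=\xi_0\partial_x+\varphi_0\partial_y$ be a smooth point symmetry of $F=0$, with $X_0F=\lambda F$ on $\Omega$ for a smooth function $\lambda(x,y,\dots,y^{(n)})$. Then $X_0$ is stable with respect to the approximation with first differential approximation $F+\varepsilon L^{(1)}_\alpha$ if and only if $$\Bigl.\bigl(X_0L^{(1)}_\alpha+(D\xi_0-\lambda)L^{(1)}_\alpha\bigr)\Bigr|_{F=0}=0\qquad\text{for all }1\le\alpha\le N,$$ i.e. the expression, in which $X_0$ acts on $(x,y,\dots,y^{(p)})$ with $h$ fixed, vanishes at every $(x,y,\dots,y^{(p)},h)$ with $(x,\dots,y^{(n)})\in\Omega$, $h\in H$ and $F(x,\dots,y^{(n)})=0$. -/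

import Mathlib

open scoped ContDiff Topology

noncomputable section

namespace FDStability

/-! ### Jets, total derivative, prolongation -/

/-- Jets of order `m`: points `(x, y, y⁽¹⁾, …, y⁽ᵐ⁾)`. In particular `Jet 0` is the `(x, y)`-plane. -/
abbrev Jet (m : ℕ) : Type := ℝ × (Fin (m + 1) → ℝ)

/-- Forget the derivatives of order `> k`. -/
def Jet.trunc {m : ℕ} (k : ℕ) (hk : k ≤ m) (z : Jet m) : Jet k :=
  (z.1, fun j => z.2 (Fin.castLE (Nat.succ_le_succ hk) j))

/-- The total derivative `D g = ∂ₓ g + y⁽¹⁾ ∂_y g + y⁽²⁾ ∂_{y⁽¹⁾} g + ⋯` of a function on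
`m`-jets, which is a function on `(m+1)`-jets. -/
def totalD {m : ℕ} (g : Jet m → ℝ) : Jet (m + 1) → ℝ := fun z =>
  fderiv ℝ g (z.trunc m (Nat.le_succ m)) ((1 : ℝ), fun j : Fin (m + 1) => z.2 j.succ)

/-- The prolongation coefficients: `φ⁽⁰⁾ = φ` and `φ⁽ⁱ⁺¹⁾ = D φ⁽ⁱ⁾ - y⁽ⁱ⁺¹⁾ D ξ`. -/
def prolongCoeff (ξ φ : Jet 0 → ℝ) : (i : ℕ) → Jet i → ℝ
  | 0 => φ
  | i + 1 => fun z =>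
      totalD (prolongCoeff ξ φ i) z
        - z.2 (Fin.last (i + 1)) * totalD ξ (z.trunc (0 + 1) (by omega))

/-- The vector field on `m`-jets given by the `m`-th prolongation of `ξ ∂ₓ + φ ∂_y`. -/
def prolong (ξ φ : Jet 0 → ℝ) (m : ℕ) (z : Jet m) : Jet m :=
  (ξ (z.trunc 0 (Nat.zero_le m)),
    fun j => prolongCoeff ξ φ j (z.trunc j (Nat.lt_succ_iff.mp j.isLt)))

/-- `X G`, where `X` is the (prolonged) operator with coefficients `ξ, φ`. -/
def applyOp (ξ φ : Jet 0 → ℝ) {m : ℕ} (G : Jet m → ℝ) (z : Jet m) : ℝ :=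
  fderiv ℝ G z (prolong ξ φ m z)

/-! ### Approximate one-parameter groups and approximate invariance (first order in `ε`) -/

section Approximate

variable {E Y : Type*} [NormedAddCommGroup E] [NormedSpace ℝ E]
  [NormedAddCommGroup Y] [NormedSpace ℝ Y]

/-- `z ↦ f₀ z a + ε f₁ z a + o(ε)`, for `z ∈ V` and `|a| < T`, is the local approximate
one-parameter group in `U` with infinitesimal operator `X₀ + ε X₁ + o(ε)`: it solves the
approximate Lie equation `∂z'/∂a = X₀(z') + ε X₁(z') + o(ε)`, `z'(0) = z + o(ε)`, which,
separated by powers of `ε`, is the Cauchy problem below. (By uniqueness `f₀`, `f₁` are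
determined by `X₀`, `X₁`.) -/
structure IsApproxGroup (U : Set E) (X₀ X₁ : E → E) (V : Set E) (T : ℝ)
    (f₀ f₁ : E → ℝ → E) : Prop where
  isOpen : IsOpen V
  subset : V ⊆ U
  pos : 0 < T
  continuousOn₀ : ContinuousOn (fun w : E × ℝ => f₀ w.1 w.2) (V ×ˢ Set.Ioo (-T) T)
  continuousOn₁ : ContinuousOn (fun w : E × ℝ => f₁ w.1 w.2) (V ×ˢ Set.Ioo (-T) T)
  mem : ∀ z ∈ V, ∀ a ∈ Set.Ioo (-T) T, f₀ z a ∈ U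
  init₀ : ∀ z ∈ V, f₀ z 0 = z
  init₁ : ∀ z ∈ V, f₁ z 0 = 0
  deriv₀ : ∀ z ∈ V, ∀ a ∈ Set.Ioo (-T) T, HasDerivAt (f₀ z) (X₀ (f₀ z a)) a
  deriv₁ : ∀ z ∈ V, ∀ a ∈ Set.Ioo (-T) T,
    HasDerivAt (f₁ z) (X₁ (f₀ z a) + fderiv ℝ X₀ (f₀ z a) (f₁ z a)) a

/-- `z = z₀ + ε z₁ + o(ε)` satisfies the approximate equation `G(z, ε) = o(ε)`. -/
def IsApproxSolution (G : E → ℝ → Y) (z : ℝ → E) (z₀ z₁ : E) : Prop :=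
  (fun ε : ℝ => z ε - z₀ - ε • z₁) =o[𝓝[>] 0] (fun ε : ℝ => ε) ∧
  (fun ε : ℝ => G (z ε) ε) =o[𝓝[>] 0] (fun ε : ℝ => ε)

/-- The approximate equation `G(z, ε) = o(ε)` on `U` is invariant with respect to the approximate
one-parameter group with operator `X₀ + ε X₁ + o(ε)`: the transformations of the group take
solutions of the approximate equation to solutions. -/
def ApproxInvariant (U : Set E) (X₀ X₁ : E → E) (G : E → ℝ → Y) : Prop :=
  ∀ (V : Set E) (T : ℝ) (f₀ f₁ : E → ℝ → E), IsApproxGroup U X₀ X₁ V T f₀ f₁ →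
    ∀ (z : ℝ → E) (z₀ z₁ : E), z₀ ∈ V → IsApproxSolution G z z₀ z₁ →
      ∀ a ∈ Set.Ioo (-T) T,
        (fun ε : ℝ => G (f₀ (z ε) a + ε • f₁ (z ε) a) ε) =o[𝓝[>] 0] (fun ε : ℝ => ε)

end Approximate

/-! ### Finite-difference approximations

There are `N + 1` nodes, indexed by `Fin (N + 1)`, and `N` step sizes, indexed by `Fin N`; the
step `i` joins the nodes `i.castSucc` and `i.succ`. -/

/-- `h_{β,α}`: the sum of the steps from node `α` to node `β`, negative if `β < α`. -/
def stepSum {N : ℕ} (h : Fin N → ℝ) (β α : Fin (N + 1)) : ℝ :=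
  (∑ i : Fin N, if i.castSucc < β then h i else 0)
    - ∑ i : Fin N, if i.castSucc < α then h i else 0

/-- The difference equations `L_α(x_1, …, u_1, …) = 0` approximate the equation `F = 0` at every
node, and `F + ε L¹_α` is the first differential approximation at the node `α`: substituting
`x_β = x_α + ε h_{β,α}`, `u_β = ∑_{k ≤ p} (ε h_{β,α})^k / k! u_α⁽ᵏ⁾` in `L_α` gives
`F + ε L¹_α + o(ε)`, for all values of `x_α, u_α, …, u_α⁽ᵖ⁾` and of the steps. -/
def IsFirstDifferentialApproximation {N n p : ℕ} (hnp : n ≤ p)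
    (Ω : Set (Jet n)) (H : Set (Fin N → ℝ)) (F : Jet n → ℝ)
    (L : Fin (N + 1) → (Fin (N + 1) → ℝ) → (Fin (N + 1) → ℝ) → ℝ)
    (L1 : Fin (N + 1) → Jet p → (Fin N → ℝ) → ℝ) : Prop :=
  ∀ (α : Fin (N + 1)) (z : Jet p) (h : Fin N → ℝ), z.trunc n hnp ∈ Ω → h ∈ H →
    (fun ε : ℝ =>
      L α (fun β => z.1 + ε * stepSum h β α)
          (fun β => ∑ k : Fin (p + 1),
            (ε * stepSum h β α) ^ (k : ℕ) / (Nat.factorial k : ℝ) * z.2 k)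
        - (F (z.trunc n hnp) + ε * L1 α z h)) =o[𝓝[>] 0] (fun ε : ℝ => ε)

/-- The unknowns of the discrete system: `x_α, u_α = u_α⁽⁰⁾, u_α⁽¹⁾, …, u_α⁽²ᵖ⁾` at every node `α`,
and the step sizes `h_i`. -/
abbrev State (N p : ℕ) : Type := (Fin (N + 1) → Jet (2 * p)) × (Fin N → ℝ)

/-- The coefficients of `X₀^Δ`: the prolongation at every node, and `σ₀ = h D ξ₀` for the steps. -/
def discreteX₀ {N p : ℕ} (hp : 1 ≤ p) (ξ₀ φ₀ : Jet 0 → ℝ) (s : State N p) : State N p :=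
  (fun α => prolong ξ₀ φ₀ (2 * p) (s.1 α),
   fun i => s.2 i * totalD ξ₀ ((s.1 i.castSucc).trunc (0 + 1) (by omega)))

/-- The coefficients of `X₁^Δ`: the prolongation at every node, and
`σ₁ = h D ξ₁ + (h² / 2) D² ξ₀` for the steps. -/
def discreteX₁ {N p : ℕ} (hp : 1 ≤ p) (ξ₀ ξ₁ φ₁ : Jet 0 → ℝ) (s : State N p) : State N p :=
  (fun α => prolong ξ₁ φ₁ (2 * p) (s.1 α),
   fun i => s.2 i * totalD ξ₁ ((s.1 i.castSucc).trunc (0 + 1) (by omega))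
     + (s.2 i) ^ 2 / 2 * totalD (totalD ξ₀) ((s.1 i.castSucc).trunc (0 + 1 + 1) (by omega)))

/-- The left-hand sides of the discrete system at the node `α`, up to `o(ε)`:
`F(x_α, …, u_α⁽ⁿ⁾) + ε L¹_α(x_α, …, u_α⁽ᵖ⁾, h)`, then
`x_{i+1} - x_i - ε h_i` for all steps `i`, then
`u_{i+1}⁽ᴶ⁾ - u_i⁽ᴶ⁾ - ε h_i u_i⁽ᴶ⁺¹⁾` for all steps `i` and all `0 ≤ J ≤ p`. -/
def discreteSystem {N n p : ℕ} (hnp : n ≤ p) (hp : 1 ≤ p) (F : Jet n → ℝ)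
    (L1 : Fin (N + 1) → Jet p → (Fin N → ℝ) → ℝ) (α : Fin (N + 1))
    (s : State N p) (ε : ℝ) : ℝ × (Fin N → ℝ) × (Fin N → Fin (p + 1) → ℝ) :=
  (F ((s.1 α).trunc n (by omega)) + ε * L1 α ((s.1 α).trunc p (by omega)) s.2,
   fun i => (s.1 i.succ).1 - (s.1 i.castSucc).1 - ε * s.2 i,
   fun i J =>
     (s.1 i.succ).2 (Fin.castLE (by omega) J) - (s.1 i.castSucc).2 (Fin.castLE (by omega) J)
       - ε * s.2 i * (s.1 i.castSucc).2 ⟨(J : ℕ) + 1, by omega⟩)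

/-- The domain of the discrete system. -/
def stateDomain {N n p : ℕ} (hnp : n ≤ p) (Ω : Set (Jet n)) (H : Set (Fin N → ℝ)) :
    Set (State N p) :=
  {s | (∀ α, (s.1 α).trunc n (by omega) ∈ Ω) ∧ s.2 ∈ H}

/-- The operator `X₀ = ξ₀ ∂ₓ + φ₀ ∂_y` is stable: there is an operator `X₁ = ξ₁ ∂ₓ + φ₁ ∂_y` such
that the approximate group `X₀^Δ + ε X₁^Δ + o(ε)` leaves the discrete system at every node (the
difference equation of the node together with all the grid relations) invariant up to `o(ε)`. -/
def IsStable {N n p : ℕ} (hnp : n ≤ p) (hp : 1 ≤ p) (B : Set (Jet 0)) (Ω : Set (Jet n))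
    (H : Set (Fin N → ℝ)) (F : Jet n → ℝ) (L1 : Fin (N + 1) → Jet p → (Fin N → ℝ) → ℝ)
    (ξ₀ φ₀ : Jet 0 → ℝ) : Prop :=
  ∃ ξ₁ φ₁ : Jet 0 → ℝ, ContDiffOn ℝ ∞ ξ₁ B ∧ ContDiffOn ℝ ∞ φ₁ B ∧
    ∀ α : Fin (N + 1),
      ApproxInvariant (stateDomain hnp Ω H) (discreteX₀ hp ξ₀ φ₀) (discreteX₁ hp ξ₀ ξ₁ φ₁)
        (discreteSystem hnp hp F L1 α)

end FDStability

end

/-! Differentiate the discrete system along `X₀^Δ + ε X₁^Δ`, up to `o(ε)`. If the derivative is a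
bounded multiple of the left-hand sides plus `ε` times a rate, Grönwall's inequality decides: a rate
vanishing along the trajectory preserves the system up to `o(ε)`, while a rate `c ≠ 0` makes the
left-hand side grow like `ε a c` for small times `a` (`IsApproxGroup.norm_transform_sub_le`,
`IsApproxGroup.rate_eq_zero`).

With `X₁ = 0` the grid relations are always preserved (`eventually_abs_deriv_grid_le`). Modulo these
relations, a function `g` of the jet changes by `ε h D g` from one node to the next, and the
prolongation formula together with `σ₀ = h D ξ₀` cancels exactly this increment; `σ₁` enters only at
order `ε²`.

For the equation, `X₀ F = λ F` leaves the rate `X₁ F + X₀^Δ L¹ - λ L¹`. At order zero in `ε` all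
nodes carry the same `p`-jet, so `X₀^Δ` scales all steps by one common factor `D ξ₀`. Substituting
`ε t` for `ε` shows that `L¹` is homogeneous of degree one in `h`, and Euler's identity turns the
scaling into `(D ξ₀) L¹`. The rate is thus `X₁ F + E(h)` with `E = X₀ L¹ + (D ξ₀ - λ) L¹`
(`eqnRate_eq`).

If `E` vanishes on `F = 0`, then `X₁ = 0` is a valid choice, because `F = 0` and the coincidence of
the nodes persist along the flow of `X₀`. Conversely, since `dF ≠ 0`, every admissible `(z, h)` with
`F = 0` underlies an approximate solution of the system, so invariance forces `X₁ F + E(h) = 0` for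
every `h ∈ H`. As `X₁ F` does not depend on `h` and `E(2h) = 2 E(h)`, both terms vanish. -/

noncomputable section

namespace FDStability

open Set Filter Asymptotics

/-! ### Grönwall estimates and approximate one-parameter groups -/

section Approximate

variable {E : Type*} [NormedAddCommGroup E] [NormedSpace ℝ E]

/-- Grönwall's inequality on the unoriented interval between `0` and `a`. -/
theorem norm_le_of_norm_deriv_le_uIcc {f f' : ℝ → E} {a δ K ε : ℝ} (hK : 0 ≤ K) (hε : 0 ≤ ε)
    (hf : ∀ t ∈ uIcc 0 a, HasDerivAt f (f' t) t) (h0 : ‖f 0‖ ≤ δ)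
    (bound : ∀ t ∈ uIcc 0 a, ‖f' t‖ ≤ K * ‖f t‖ + ε) :
    ‖f a‖ ≤ (δ + |a| * ε) * Real.exp (K * |a|) := by
  have hmem : ∀ s ∈ Icc (0 : ℝ) 1, s * a ∈ uIcc 0 a := by
    intro s hs
    rcases le_total 0 a with h | h
    · rw [uIcc_of_le h]
      exact ⟨mul_nonneg hs.1 h, by nlinarith [hs.2]⟩
    · rw [uIcc_of_ge h]
      exact ⟨by nlinarith [hs.2], by nlinarith [hs.1]⟩
  have hd : ∀ s ∈ Icc (0 : ℝ) 1, HasDerivAt (fun s => f (s * a)) (a • f' (s * a)) s := by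
    intro s hs
    have := (hf _ (hmem s hs)).scomp s ((hasDerivAt_id s).mul_const a)
    simpa [Function.comp_def] using this
  -- The reparametrisation `s ↦ f (s a)` on `[0, 1]` treats both signs of `a` at once.
  have key := norm_le_gronwallBound_of_norm_deriv_right_le (f := fun s => f (s * a))
    (f' := fun s => a • f' (s * a)) (δ := δ) (K := K * |a|) (ε := |a| * ε) (a := 0) (b := 1)
    (fun s hs => (hd s hs).continuousAt.continuousWithinAt)
    (fun s hs => (hd s (Ico_subset_Icc_self hs)).hasDerivWithinAt) (by simpa using h0)
    (fun s hs => by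
      rw [norm_smul, Real.norm_eq_abs]
      have := mul_le_mul_of_nonneg_left (bound _ (hmem s (Ico_subset_Icc_self hs))) (abs_nonneg a)
      linarith) 1 (right_mem_Icc.2 zero_le_one)
  simp only [one_mul, sub_zero] at key
  refine key.trans ?_
  have hδ : 0 ≤ δ := (norm_nonneg _).trans h0
  have hy : 0 ≤ K * |a| := by positivity
  have hx : 0 ≤ |a| * ε := by positivity
  generalize K * |a| = y at hy ⊢
  generalize |a| * ε = x at hx ⊢
  rcases hy.eq_or_lt with rfl | hy
  · simp [gronwallBound_K0]
  · rw [gronwallBound_of_K_ne_0 hy.ne']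
    -- This removes the division by `K` from the Grönwall bound, so that `K = 0` is no exception.
    have h1 : Real.exp y - 1 ≤ y * Real.exp y := by
      have := Real.add_one_le_exp (-y)
      have h2 : Real.exp (-y) * Real.exp y = 1 := by rw [← Real.exp_add]; simp
      nlinarith [Real.exp_pos y]
    have h3 : x / y * (Real.exp y - 1) ≤ x * Real.exp y := by
      rw [div_mul_eq_mul_div, div_le_iff₀ hy]
      nlinarith
    simp only [mul_one]
    linarith

/-- A property that holds eventually in `l ×ˢ 𝓝 t` for every `t` of a compact set holds
eventually in `l`, uniformly on the compact set. -/
theorem eventually_forall_mem_of_isCompact {α β : Type*} [TopologicalSpace β] {l : Filter α}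
    {S : Set β} (hS : IsCompact S) {P : α → β → Prop}
    (hP : ∀ t ∈ S, ∀ᶠ x in l ×ˢ 𝓝 t, P x.1 x.2) : ∀ᶠ ε in l, ∀ t ∈ S, P ε t := by
  simp only [← eventually_iSup, ← hS.prod_nhdsSet_eq_biSup] at hP
  exact hP.curry.mono fun _ h ↦ h.self_of_nhdsSet

/-- Two integral curves, in an open set, of a vector field that is continuously differentiable
there coincide as soon as they agree at the time `0`. -/
theorem eqOn_of_hasDerivAt_of_contDiffOn {W : Set E} (hW : IsOpen W) {v : E → E}
    (hv : ContDiffOn ℝ 1 v W) {γ₁ γ₂ : ℝ → E} {T : ℝ}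
    (h₁ : ∀ t ∈ Ioo (-T) T, HasDerivAt γ₁ (v (γ₁ t)) t ∧ γ₁ t ∈ W)
    (h₂ : ∀ t ∈ Ioo (-T) T, HasDerivAt γ₂ (v (γ₂ t)) t ∧ γ₂ t ∈ W)
    (h0 : γ₁ 0 = γ₂ 0) : EqOn γ₁ γ₂ (Ioo (-T) T) := by
  intro t ht
  obtain ⟨T', htT', hT'⟩ : ∃ T', |t| < T' ∧ T' < T := exists_between (abs_lt.2 ht)
  have hsub : Icc (-T') T' ⊆ Ioo (-T) T := fun s hs => ⟨by linarith [hs.1], by linarith [hs.2]⟩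
  -- The two arcs form a compact subset of `W`, and on a compact set a locally Lipschitz field is
  -- Lipschitz; no convexity is needed.
  set S : Set E := γ₁ '' Icc (-T') T' ∪ γ₂ '' Icc (-T') T'
  have hS : IsCompact S := by
    refine (isCompact_Icc.image_of_continuousOn fun s hs => ?_).union
      (isCompact_Icc.image_of_continuousOn fun s hs => ?_)
    · exact (h₁ s (hsub hs)).1.continuousAt.continuousWithinAt
    · exact (h₂ s (hsub hs)).1.continuousAt.continuousWithinAt
  have hSW : S ⊆ W := by
    rintro _ (⟨s, hs, rfl⟩ | ⟨s, hs, rfl⟩)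
    · exact (h₁ s (hsub hs)).2
    · exact (h₂ s (hsub hs)).2
  obtain ⟨K, hK⟩ : ∃ K, LipschitzOnWith K v S := by
    refine LocallyLipschitzOn.exists_lipschitzOnWith_of_compact hS fun x hx => ?_
    obtain ⟨K, t, ht, hl⟩ := ((hv.contDiffAt (hW.mem_nhds (hSW hx))).exists_lipschitzOnWith)
    exact ⟨K, t, mem_nhdsWithin_of_mem_nhds ht, hl⟩
  refine ODE_solution_unique_of_mem_Ioo (v := fun _ => v) (s := fun _ => S) (t₀ := 0)
    (a := -T') (b := T') (fun _ _ => hK) ?_ ?_ ?_ h0 (abs_lt.1 htT')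
  · have := abs_nonneg t
    exact ⟨by linarith, by linarith⟩
  · exact fun s hs => ⟨(h₁ s (hsub (Ioo_subset_Icc_self hs))).1,
      Or.inl ⟨s, Ioo_subset_Icc_self hs, rfl⟩⟩
  · exact fun s hs => ⟨(h₂ s (hsub (Ioo_subset_Icc_self hs))).1,
      Or.inr ⟨s, Ioo_subset_Icc_self hs, rfl⟩⟩

namespace IsApproxGroup

variable {U V : Set E} {X₀ X₁ : E → E} {T : ℝ} {f₀ f₁ : E → ℝ → E} {z : ℝ → E} {z₀ : E} {t : ℝ}

/-- Limits are taken jointly in `ε` and in the time: compactness of the time interval then gives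
uniform estimates (`eventually_forall_mem_of_isCompact`). -/
theorem tendsto₀ (hg : IsApproxGroup U X₀ X₁ V T f₀ f₁) (hz₀ : z₀ ∈ V)
    (hz : Tendsto z (𝓝[>] 0) (𝓝 z₀)) (ht : t ∈ Ioo (-T) T) :
    Tendsto (fun x : ℝ × ℝ => f₀ (z x.1) x.2) (𝓝[>] 0 ×ˢ 𝓝 t) (𝓝 (f₀ z₀ t)) := by
  have h := (hg.continuousOn₀.continuousAt (x := (z₀, t))
    ((hg.isOpen.prod isOpen_Ioo).mem_nhds ⟨hz₀, ht⟩)).tendsto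
  rw [nhds_prod_eq] at h
  exact h.comp (hz.prodMap tendsto_id)

theorem tendsto₁ (hg : IsApproxGroup U X₀ X₁ V T f₀ f₁) (hz₀ : z₀ ∈ V)
    (hz : Tendsto z (𝓝[>] 0) (𝓝 z₀)) (ht : t ∈ Ioo (-T) T) :
    Tendsto (fun x : ℝ × ℝ => f₁ (z x.1) x.2) (𝓝[>] 0 ×ˢ 𝓝 t) (𝓝 (f₁ z₀ t)) := by
  have h := (hg.continuousOn₁.continuousAt (x := (z₀, t))
    ((hg.isOpen.prod isOpen_Ioo).mem_nhds ⟨hz₀, ht⟩)).tendsto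
  rw [nhds_prod_eq] at h
  exact h.comp (hz.prodMap tendsto_id)

theorem tendsto_add_smul (hg : IsApproxGroup U X₀ X₁ V T f₀ f₁) (hz₀ : z₀ ∈ V)
    (hz : Tendsto z (𝓝[>] 0) (𝓝 z₀)) (ht : t ∈ Ioo (-T) T) :
    Tendsto (fun x : ℝ × ℝ => f₀ (z x.1) x.2 + x.1 • f₁ (z x.1) x.2) (𝓝[>] 0 ×ˢ 𝓝 t)
      (𝓝 (f₀ z₀ t)) := by
  have hε : Tendsto (fun x : ℝ × ℝ => x.1) (𝓝[>] (0 : ℝ) ×ˢ 𝓝 t) (𝓝 0) :=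
    (tendsto_nhdsWithin_of_tendsto_nhds tendsto_id).comp tendsto_fst |>.mono_right le_rfl
  simpa using (hg.tendsto₀ hz₀ hz ht).add (hε.smul (hg.tendsto₁ hz₀ hz ht))

/-- The approximate transformations satisfy the ordinary differential equation of `X₀ + ε X₁` up to
`o(ε)`, locally uniformly in time. -/
theorem isLittleO_deriv_sub (hU : IsOpen U) (hX₀ : ContDiffOn ℝ 1 X₀ U) (hX₁ : ContinuousOn X₁ U)
    (hg : IsApproxGroup U X₀ X₁ V T f₀ f₁) (hz₀ : z₀ ∈ V)
    (hz : Tendsto z (𝓝[>] 0) (𝓝 z₀)) (ht : t ∈ Ioo (-T) T) :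
    (fun x : ℝ × ℝ => X₀ (f₀ (z x.1) x.2)
        + x.1 • (X₁ (f₀ (z x.1) x.2) + fderiv ℝ X₀ (f₀ (z x.1) x.2) (f₁ (z x.1) x.2))
        - (X₀ (f₀ (z x.1) x.2 + x.1 • f₁ (z x.1) x.2)
          + x.1 • X₁ (f₀ (z x.1) x.2 + x.1 • f₁ (z x.1) x.2)))
      =o[𝓝[>] 0 ×ˢ 𝓝 t] fun x : ℝ × ℝ => x.1 := by
  have h0 := hg.tendsto₀ hz₀ hz ht
  have h1 := hg.tendsto₁ hz₀ hz ht
  have hq := hg.tendsto_add_smul hz₀ hz ht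
  have hw : U ∈ 𝓝 (f₀ z₀ t) := hU.mem_nhds (hg.mem _ hz₀ _ ht)
  -- Strict differentiability is needed because both arguments of the difference of `X₀` move with
  -- `ε` and the time.
  have hstrict : HasStrictFDerivAt X₀ (fderiv ℝ X₀ (f₀ z₀ t)) (f₀ z₀ t) :=
    (hX₀.contDiffAt hw).hasStrictFDerivAt one_ne_zero
  have e0 : (fun x : ℝ × ℝ => x.1 • f₁ (z x.1) x.2) =O[𝓝[>] 0 ×ˢ 𝓝 t]
      fun x : ℝ × ℝ => x.1 • (1 : ℝ) := (isBigO_refl _ _).smul (h1.isBigO_one ℝ)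
  have e1 := (hstrict.isLittleO.comp_tendsto (hq.prodMk_nhds h0)).trans_isBigO
    (k := fun x : ℝ × ℝ => x.1) (by simpa [Function.comp_def] using e0)
  have c1 : Tendsto (fun x : ℝ × ℝ => X₁ (f₀ (z x.1) x.2)) (𝓝[>] 0 ×ˢ 𝓝 t)
      (𝓝 (X₁ (f₀ z₀ t))) := (hX₁.continuousAt hw).tendsto.comp h0
  have c2 : Tendsto (fun x : ℝ × ℝ => X₁ (f₀ (z x.1) x.2 + x.1 • f₁ (z x.1) x.2))
      (𝓝[>] 0 ×ˢ 𝓝 t) (𝓝 (X₁ (f₀ z₀ t))) := (hX₁.continuousAt hw).tendsto.comp hq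
  have c3 : Tendsto (fun x : ℝ × ℝ => fderiv ℝ X₀ (f₀ (z x.1) x.2)) (𝓝[>] 0 ×ˢ 𝓝 t)
      (𝓝 (fderiv ℝ X₀ (f₀ z₀ t))) :=
    ((hX₀.continuousOn_fderiv_of_isOpen hU le_rfl).continuousAt hw).tendsto.comp h0
  have c3' : Tendsto (fun x : ℝ × ℝ => fderiv ℝ X₀ (f₀ (z x.1) x.2) (f₁ (z x.1) x.2))
      (𝓝[>] 0 ×ˢ 𝓝 t) (𝓝 (fderiv ℝ X₀ (f₀ z₀ t) (f₁ z₀ t))) :=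
    (isBoundedBilinearMap_apply.continuous.tendsto
      (fderiv ℝ X₀ (f₀ z₀ t), f₁ z₀ t)).comp (c3.prodMk_nhds h1)
  have c4 := (c1.sub c2).add
    (c3'.sub (((fderiv ℝ X₀ (f₀ z₀ t)).continuous.tendsto _).comp h1))
  have e2 : (fun x : ℝ × ℝ => x.1 • (X₁ (f₀ (z x.1) x.2)
      - X₁ (f₀ (z x.1) x.2 + x.1 • f₁ (z x.1) x.2)
      + (fderiv ℝ X₀ (f₀ (z x.1) x.2) (f₁ (z x.1) x.2)
        - fderiv ℝ X₀ (f₀ z₀ t) (f₁ (z x.1) x.2)))) =o[𝓝[>] 0 ×ˢ 𝓝 t]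
      fun x : ℝ × ℝ => x.1 • (1 : ℝ) := by
    refine (isBigO_refl _ _).smul_isLittleO ((isLittleO_one_iff ℝ).2 ?_)
    simpa using c4
  have e3 := e2.sub (by simpa using e1)
  simp only [smul_eq_mul, mul_one] at e3
  refine e3.congr_left fun x => ?_
  simp only [Function.comp_def, smul_add, smul_sub, map_add, map_smul, add_sub_cancel_left]
  abel

/-- If the derivative of `A + ε B` along `X₀ + ε X₁` is `ε c` up to `K |A + ε B| + η ε`, near a
trajectory of `X₀`, and `A + ε B = o(ε)` initially, then the value of `A + ε B` on the transformed
points is close to `ε a c`. -/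
theorem norm_transform_sub_le {ι : Type*} [Fintype ι] (hU : IsOpen U)
    (hX₀ : ContDiffOn ℝ 1 X₀ U) (hX₁ : ContinuousOn X₁ U)
    (hg : IsApproxGroup U X₀ X₁ V T f₀ f₁) (hz₀ : z₀ ∈ V)
    (hz : Tendsto z (𝓝[>] 0) (𝓝 z₀)) {A B : ι → E → ℝ} (hA : ∀ i, ContDiffOn ℝ 1 (A i) U)
    (hB : ∀ i, ContDiffOn ℝ 1 (B i) U) {a : ℝ} (ha : a ∈ Ioo (-T) T) {K δ η : ℝ} (hK : 0 ≤ K)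
    (hδ : 0 < δ) (hη : 0 < η) (c : ι → ℝ)
    (hinf : ∀ t ∈ uIcc 0 a, ∀ i, ∀ᶠ x : E × ℝ in 𝓝 (f₀ z₀ t) ×ˢ 𝓝[>] 0,
      |fderiv ℝ (A i) x.1 (X₀ x.1 + x.2 • X₁ x.1)
          + x.2 * fderiv ℝ (B i) x.1 (X₀ x.1 + x.2 • X₁ x.1) - x.2 * c i|
        ≤ K * ‖fun j => A j x.1 + x.2 * B j x.1‖ + η * x.2)
    (h0 : (fun ε i => A i (z ε) + ε * B i (z ε)) =o[𝓝[>] 0] fun ε : ℝ => ε) :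
    ∀ᶠ ε in 𝓝[>] (0 : ℝ),
      ‖fun i => A i (f₀ (z ε) a + ε • f₁ (z ε) a) + ε * B i (f₀ (z ε) a + ε • f₁ (z ε) a)
          - ε * (a * c i)‖
        ≤ ε * ((δ + |a| * (K * (|a| * ‖c‖) + 2 * η)) * Real.exp (K * |a|)) := by
  set q : ℝ → ℝ → E := fun ε t => f₀ (z ε) t + ε • f₁ (z ε) t with hq
  set q' : ℝ → ℝ → E := fun ε t => X₀ (f₀ (z ε) t)
    + ε • (X₁ (f₀ (z ε) t) + fderiv ℝ X₀ (f₀ (z ε) t) (f₁ (z ε) t)) with hq'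
  have hT : 0 < T := hg.pos
  have hsub : uIcc 0 a ⊆ Ioo (-T) T := by
    intro s hs
    rcases le_total 0 a with h | h
    · rw [uIcc_of_le h] at hs
      exact ⟨by linarith [hs.1], by linarith [hs.2, ha.2]⟩
    · rw [uIcc_of_ge h] at hs
      exact ⟨by linarith [hs.1, ha.1], by linarith [hs.2]⟩
  have hpos : ∀ᶠ ε : ℝ in 𝓝[>] 0, 0 < ε := self_mem_nhdsWithin
  have hV : ∀ᶠ ε in 𝓝[>] 0, z ε ∈ V := hz (hg.isOpen.mem_nhds hz₀)
  have hqU : ∀ᶠ ε in 𝓝[>] (0 : ℝ), ∀ t ∈ uIcc 0 a, q ε t ∈ U :=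
    eventually_forall_mem_of_isCompact isCompact_uIcc fun t ht =>
      hg.tendsto_add_smul hz₀ hz (hsub ht) (hU.mem_nhds (hg.mem _ hz₀ _ (hsub ht)))
  have hε : ∀ t : ℝ, Tendsto (fun x : ℝ × ℝ => x.1) (𝓝[>] (0 : ℝ) ×ˢ 𝓝 t) (𝓝[>] 0) :=
    fun t => tendsto_fst
  -- One `η` comes from `hinf`, the other from replacing the true velocity `q'` by `X₀ + ε X₁` at
  -- `q`.
  have hmain : ∀ᶠ ε in 𝓝[>] (0 : ℝ), ∀ t ∈ uIcc 0 a, ∀ i,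
      |fderiv ℝ (A i) (q ε t) (q' ε t) + ε * fderiv ℝ (B i) (q ε t) (q' ε t) - ε * c i|
        ≤ K * ‖fun j => A j (q ε t) + ε * B j (q ε t)‖ + 2 * η * ε := by
    refine eventually_forall_mem_of_isCompact isCompact_uIcc fun t ht => ?_
    rw [eventually_all]
    intro i
    have hqt := hg.tendsto_add_smul hz₀ hz (hsub ht)
    have hw : U ∈ 𝓝 (f₀ z₀ t) := hU.mem_nhds (hg.mem _ hz₀ _ (hsub ht))
    have hAt := (((hA i).continuousOn_fderiv_of_isOpen hU le_rfl).continuousAt hw).tendsto.comp hqt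
    have hBt := (((hB i).continuousOn_fderiv_of_isOpen hU le_rfl).continuousAt hw).tendsto.comp hqt
    have hAB := hAt.add (((hε t).mono_right nhdsWithin_le_nhds).smul hBt)
    have hbd := hAB.isBigO_one ℝ
    have herr := hg.isLittleO_deriv_sub hU hX₀ hX₁ hz₀ hz (hsub ht)
    have hdir : (fun x : ℝ × ℝ => (fderiv ℝ (A i) (q x.1 x.2) + x.1 • fderiv ℝ (B i) (q x.1 x.2))
        (q' x.1 x.2 - (X₀ (q x.1 x.2) + x.1 • X₁ (q x.1 x.2)))) =o[𝓝[>] 0 ×ˢ 𝓝 t]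
        fun x : ℝ × ℝ => x.1 := by
      have h1 : (fun x : ℝ × ℝ => ‖fderiv ℝ (A i) (q x.1 x.2) + x.1 • fderiv ℝ (B i) (q x.1 x.2)‖
        * ‖q' x.1 x.2 - (X₀ (q x.1 x.2) + x.1 • X₁ (q x.1 x.2))‖) =o[𝓝[>] 0 ×ˢ 𝓝 t]
        fun x : ℝ × ℝ => 1 * x.1 := hbd.norm_left.mul_isLittleO herr.norm_left
      simp only [one_mul] at h1
      refine (IsBigO.of_norm_le fun x => ?_).trans_isLittleO h1
      exact ContinuousLinearMap.le_opNorm _ _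
    filter_upwards [hdir.def hη, (hqt.prodMk (hε t)).eventually (hinf t ht i),
      (hε t).eventually hpos] with x h1 h2 h3
    simp only [Real.norm_eq_abs, abs_of_pos h3] at h1
    have h4 : fderiv ℝ (A i) (q x.1 x.2) (q' x.1 x.2)
        + x.1 * fderiv ℝ (B i) (q x.1 x.2) (q' x.1 x.2)
        - x.1 * c i = (fderiv ℝ (A i) (q x.1 x.2) (X₀ (q x.1 x.2) + x.1 • X₁ (q x.1 x.2))
          + x.1 * fderiv ℝ (B i) (q x.1 x.2) (X₀ (q x.1 x.2) + x.1 • X₁ (q x.1 x.2)) - x.1 * c i)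
        + (fderiv ℝ (A i) (q x.1 x.2) + x.1 • fderiv ℝ (B i) (q x.1 x.2))
        (q' x.1 x.2 - (X₀ (q x.1 x.2) + x.1 • X₁ (q x.1 x.2))) := by
      simp only [add_apply, smul_apply, map_sub,
        smul_eq_mul]
      ring
    rw [h4]
    refine (abs_add_le _ _).trans ?_
    have h2' : |fderiv ℝ (A i) (q x.1 x.2) (X₀ (q x.1 x.2) + x.1 • X₁ (q x.1 x.2))
          + x.1 * fderiv ℝ (B i) (q x.1 x.2) (X₀ (q x.1 x.2) + x.1 • X₁ (q x.1 x.2)) - x.1 * c i|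
          ≤ K * ‖fun j => A j (q x.1 x.2) + x.1 * B j (q x.1 x.2)‖ + η * x.1 := h2
    linarith
  filter_upwards [hpos, hV, hqU, hmain, h0.def hδ] with ε hε0 hεV hεU hεm hε0'
  have hder : ∀ t ∈ uIcc 0 a, HasDerivAt (q ε) (q' ε t) t := fun t ht =>
    (hg.deriv₀ _ hεV _ (hsub ht)).add ((hg.deriv₁ _ hεV _ (hsub ht)).const_smul ε)
  have hcomp : ∀ t ∈ uIcc 0 a, HasDerivAt
      (fun t i => A i (q ε t) + ε * B i (q ε t) - ε * (t * c i))
      (fun i => fderiv ℝ (A i) (q ε t) (q' ε t) + ε * fderiv ℝ (B i) (q ε t) (q' ε t)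
        - ε * c i) t := by
    intro t ht
    rw [hasDerivAt_pi]
    intro i
    have hw : U ∈ 𝓝 (q ε t) := hU.mem_nhds (hεU t ht)
    have dA := (((hA i).contDiffAt hw).differentiableAt one_ne_zero).hasFDerivAt.comp_hasDerivAt t
      (hder t ht)
    have dB := (((hB i).contDiffAt hw).differentiableAt one_ne_zero).hasFDerivAt.comp_hasDerivAt t
      (hder t ht)
    have dc : HasDerivAt (fun t : ℝ => ε * (t * c i)) (ε * c i) t := by
      simpa using ((hasDerivAt_id t).mul_const (c i)).const_mul ε
    exact (dA.add (dB.const_mul ε)).sub dc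
  have hq0 : q ε 0 = z ε := by simp [hq, hg.init₀ _ hεV, hg.init₁ _ hεV]
  have hmem : ∀ t ∈ uIcc 0 a, |t| ≤ |a| := by
    intro s hs
    simpa using abs_sub_left_of_mem_uIcc hs
  -- Grönwall is applied after subtracting the expected drift `ε t c`; passing from `A + ε B` to
  -- this difference costs at most `K ε |a| ‖c‖`.
  have key := norm_le_of_norm_deriv_le_uIcc (δ := δ * ε) (K := K)
    (ε := K * (ε * (|a| * ‖c‖)) + 2 * η * ε) hK (by positivity) hcomp
    (by simpa [hq0, abs_of_pos hε0] using hε0') (by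
      intro t ht
      rw [pi_norm_le_iff_of_nonneg (by positivity)]
      intro i
      refine (hεm t ht i).trans ?_
      have h5 : ‖fun j => A j (q ε t) + ε * B j (q ε t)‖
          ≤ ‖fun i => A i (q ε t) + ε * B i (q ε t) - ε * (t * c i)‖ + ε * (|a| * ‖c‖) := by
        have h6 : (fun j => A j (q ε t) + ε * B j (q ε t))
            = (fun i => A i (q ε t) + ε * B i (q ε t) - ε * (t * c i)) + ε • t • c := by
          ext j
          simp
        rw [h6]
        refine (norm_add_le _ _).trans ?_
        gcongr
        rw [norm_smul, norm_smul, Real.norm_eq_abs, Real.norm_eq_abs, abs_of_pos hε0]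
        have := hmem t ht
        gcongr
      have := mul_le_mul_of_nonneg_left h5 hK
      linarith)
  refine key.trans (le_of_eq ?_)
  ring

/-- If the derivative of `A + ε B` along `X₀ + ε X₁` is bounded by `K |A + ε B| + o(ε)` near a
trajectory of `X₀`, then the equation `A + ε B = o(ε)` is preserved along this trajectory. -/
theorem isLittleO_transform {ι : Type*} [Fintype ι] (hU : IsOpen U)
    (hX₀ : ContDiffOn ℝ 1 X₀ U) (hX₁ : ContinuousOn X₁ U)
    (hg : IsApproxGroup U X₀ X₁ V T f₀ f₁) (hz₀ : z₀ ∈ V)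
    (hz : Tendsto z (𝓝[>] 0) (𝓝 z₀)) {A B : ι → E → ℝ} (hA : ∀ i, ContDiffOn ℝ 1 (A i) U)
    (hB : ∀ i, ContDiffOn ℝ 1 (B i) U) {a : ℝ} (ha : a ∈ Ioo (-T) T) {K : ℝ} (hK : 0 ≤ K)
    (hinf : ∀ t ∈ uIcc 0 a, ∀ i, ∀ η > 0, ∀ᶠ x : E × ℝ in 𝓝 (f₀ z₀ t) ×ˢ 𝓝[>] 0,
      |fderiv ℝ (A i) x.1 (X₀ x.1 + x.2 • X₁ x.1)
          + x.2 * fderiv ℝ (B i) x.1 (X₀ x.1 + x.2 • X₁ x.1)|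
        ≤ K * ‖fun j => A j x.1 + x.2 * B j x.1‖ + η * x.2)
    (h0 : (fun ε i => A i (z ε) + ε * B i (z ε)) =o[𝓝[>] 0] fun ε : ℝ => ε) :
    (fun ε i => A i (f₀ (z ε) a + ε • f₁ (z ε) a) + ε * B i (f₀ (z ε) a + ε • f₁ (z ε) a))
      =o[𝓝[>] 0] fun ε : ℝ => ε := by
  rw [isLittleO_iff]
  intro C hC
  -- With `c = 0` and `δ = η = C / M`, the bound of `norm_transform_sub_le` is exactly `C ε`.
  set M := (1 + |a| * 2) * Real.exp (K * |a|) with hM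
  have hM0 : 0 < M := by positivity
  have := hg.norm_transform_sub_le hU hX₀ hX₁ hz₀ hz hA hB ha hK (δ := C / M) (η := C / M)
    (by positivity) (by positivity) 0
    (fun t ht i => by simpa using hinf t ht i (C / M) (by positivity)) h0
  filter_upwards [this, self_mem_nhdsWithin] with ε h1 (h2 : 0 < ε)
  simp only [Pi.zero_apply, mul_zero, sub_zero, norm_zero, zero_add] at h1
  rw [Real.norm_eq_abs, abs_of_pos h2]
  refine h1.trans (le_of_eq ?_)
  have : (C / M + |a| * (2 * (C / M))) * Real.exp (K * |a|) = C / M * M := by rw [hM]; ring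
  rw [this]
  field_simp

end IsApproxGroup

/-- Existence of the approximate group near a point. -/
theorem exists_isApproxGroup [CompleteSpace E] {U : Set E} (hU : IsOpen U) {X₀ X₁ : E → E}
    (hX₀ : ContDiffOn ℝ 2 X₀ U) (hX₁ : ContDiffOn ℝ 1 X₁ U) {z₀ : E} (hz₀ : z₀ ∈ U) :
    ∃ (V : Set E) (T : ℝ) (f₀ f₁ : E → ℝ → E), z₀ ∈ V ∧ IsApproxGroup U X₀ X₁ V T f₀ f₁ := by
  -- The flow of `X₀` is coupled with its inhomogeneous variational equation and started at `(z,
  -- 0)`. `W` is `C¹` because `X₀` is `C²`.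
  set W : E × E → E × E := fun w => (X₀ w.1, X₁ w.1 + fderiv ℝ X₀ w.1 w.2) with hW
  have hWs : ContDiffAt ℝ 1 W (z₀, 0) := by
    have h1 : ContDiffAt ℝ 1 (fun w : E × E => X₀ w.1) (z₀, 0) :=
      ((hX₀.contDiffAt (hU.mem_nhds hz₀)).of_le one_le_two).comp (z₀, (0 : E)) contDiffAt_fst
    have h2 : ContDiffAt ℝ 1 (fun w : E × E => X₁ w.1) (z₀, 0) :=
      (hX₁.contDiffAt (hU.mem_nhds hz₀)).comp (z₀, (0 : E)) contDiffAt_fst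
    have h3 : ContDiffAt ℝ 1 (fun w : E × E => fderiv ℝ X₀ w.1) (z₀, 0) :=
      ((hX₀.fderiv_of_isOpen hU (m := 1) (by norm_num)).contDiffAt
        (hU.mem_nhds hz₀)).comp (z₀, (0 : E)) contDiffAt_fst
    exact h1.prodMk (h2.add (h3.clm_apply contDiffAt_snd))
  obtain ⟨τ, hτ, ρ, r, L, K, hr, hpl⟩ := IsPicardLindelof.of_contDiffAt_one hWs
  obtain ⟨α, hα, hαc⟩ :=
    (hpl 0).exists_forall_mem_closedBall_eq_hasDerivWithinAt_continuousOn
  simp only [zero_sub, zero_add] at hα hαc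
  have hcont : ContinuousOn (fun w : E × ℝ => α ((w.1, 0), w.2))
      (Metric.ball z₀ r ×ˢ Ioo (-τ) τ) := by
    refine hαc.comp (by fun_prop) fun w hw => ⟨?_, Ioo_subset_Icc_self hw.2⟩
    have := hw.1
    simp only [Metric.mem_ball, Metric.mem_closedBall, Prod.dist_eq, dist_self] at this ⊢
    exact max_le this.le r.2
  have hrpos : (0 : ℝ) < r := hr
  have h0 : (z₀, (0 : ℝ)) ∈ Metric.ball z₀ r ×ˢ Ioo (-τ) τ :=
    ⟨Metric.mem_ball_self hrpos, by constructor <;> linarith⟩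
  have hmemc : ∀ x ∈ Metric.ball z₀ r, ((x, 0) : E × E) ∈ Metric.closedBall (z₀, (0 : E)) r := by
    intro x hx
    simp only [Metric.mem_ball, Metric.mem_closedBall, Prod.dist_eq, dist_self] at hx ⊢
    exact max_le hx.le r.2
  -- Picard–Lindelöf does not keep the first component in `U`; continuity does, after shrinking the
  -- neighbourhood and the time.
  have hev : ∀ᶠ w : E × ℝ in 𝓝 (z₀, 0), (α ((w.1, 0), w.2)).1 ∈ U := by
    have hca := (hcont.continuousAt ((Metric.isOpen_ball.prod isOpen_Ioo).mem_nhds h0)).fst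
    refine hca.tendsto (hU.mem_nhds ?_)
    simpa [(hα _ (hmemc z₀ h0.1)).1] using hz₀
  rw [nhds_prod_eq, eventually_prod_iff] at hev
  obtain ⟨p1, hp1, p2, hp2, hp⟩ := hev
  obtain ⟨V', hV'1, hV'o, hV'z⟩ := eventually_nhds_iff.1 hp1
  obtain ⟨τ', hτ', hτ'p⟩ := Metric.eventually_nhds_iff.1 hp2
  set V := V' ∩ Metric.ball z₀ r ∩ U with hVdef
  set T := min τ τ' with hT
  have hT0 : 0 < T := lt_min hτ hτ'
  have hTsub : Ioo (-T) T ⊆ Ioo (-τ) τ :=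
    Ioo_subset_Ioo (neg_le_neg (min_le_left _ _)) (min_le_left _ _)
  have hd : ∀ z ∈ V, ∀ a ∈ Ioo (-T) T,
      HasDerivAt (fun t => α ((z, 0), t)) (W (α ((z, 0), a))) a := by
    intro z hz a ha
    exact ((hα _ (hmemc z hz.1.2)).2 a (Ioo_subset_Icc_self (hTsub ha))).hasDerivAt
      (Icc_mem_nhds (hTsub ha).1 (hTsub ha).2)
  have hc : ContinuousOn (fun w : E × ℝ => α ((w.1, 0), w.2)) (V ×ˢ Ioo (-T) T) :=
    hcont.mono (prod_mono (fun z hz => hz.1.2) hTsub)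
  refine ⟨V, T, fun z a => (α ((z, 0), a)).1, fun z a => (α ((z, 0), a)).2, ⟨⟨hV'z, h0.1⟩, hz₀⟩, ?_⟩
  exact {
    isOpen := (hV'o.inter Metric.isOpen_ball).inter hU
    subset := fun z hz => hz.2
    pos := hT0
    continuousOn₀ := hc.fst
    continuousOn₁ := hc.snd
    mem := fun z hz a ha => hp (hV'1 z hz.1.1) (hτ'p (by
      rw [Real.dist_eq, sub_zero, abs_lt]
      exact ⟨by linarith [ha.1, min_le_right τ τ'], by linarith [ha.2, min_le_right τ τ']⟩))
    init₀ := fun z hz => by rw [(hα _ (hmemc z hz.1.2)).1]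
    init₁ := fun z hz => by rw [(hα _ (hmemc z hz.1.2)).1]
    deriv₀ := fun z hz a ha => (hd z hz a ha).fst
    deriv₁ := fun z hz a ha => (hd z hz a ha).snd }

end Approximate

/-! ### Smoothness of prolongations on jet spaces -/

section Jets

/-- Truncation of jets as a continuous linear map. -/
def truncL {m : ℕ} (k : ℕ) (hk : k ≤ m) : Jet m →L[ℝ] Jet k where
  toFun := Jet.trunc k hk
  map_add' _ _ := rfl
  map_smul' _ _ := rfl
  cont := by
    unfold Jet.trunc
    fun_prop

theorem contDiff_trunc {m k : ℕ} (hk : k ≤ m) : ContDiff ℝ ∞ (Jet.trunc k hk : Jet m → Jet k) :=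
  (truncL k hk).contDiff

theorem continuous_trunc {m k : ℕ} (hk : k ≤ m) : Continuous (Jet.trunc k hk : Jet m → Jet k) :=
  (truncL k hk).continuous

/-- The direction along which `totalD` differentiates. -/
def jetShift {m : ℕ} (z : Jet (m + 1)) : Jet m := (1, fun j => z.2 j.succ)

theorem contDiff_jetShift {m : ℕ} : ContDiff ℝ ∞ (jetShift : Jet (m + 1) → Jet m) := by
  unfold jetShift
  fun_prop

/-- The jets of order `m` over a set of the plane. -/
def jetsOver (B : Set (Jet 0)) (m : ℕ) : Set (Jet m) := {z | z.trunc 0 (Nat.zero_le m) ∈ B}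

variable {B : Set (Jet 0)} {m : ℕ}

theorem isOpen_jetsOver (hB : IsOpen B) : IsOpen (jetsOver B m) :=
  hB.preimage (continuous_trunc _)

theorem contDiffOn_totalD (hB : IsOpen B) {g : Jet m → ℝ} (hg : ContDiffOn ℝ ∞ g (jetsOver B m)) :
    ContDiffOn ℝ ∞ (totalD g) (jetsOver B (m + 1)) := by
  have h1 : ContDiffOn ℝ ∞ (fderiv ℝ g) (jetsOver B m) :=
    hg.fderiv_of_isOpen (isOpen_jetsOver hB) (by simp)
  have h2 : ContDiffOn ℝ ∞ (fun z : Jet (m + 1) => fderiv ℝ g (z.trunc m (Nat.le_succ m)))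
      (jetsOver B (m + 1)) := h1.comp (contDiff_trunc _).contDiffOn fun z hz => hz
  exact h2.clm_apply contDiff_jetShift.contDiffOn

variable {ξ φ : Jet 0 → ℝ}

theorem contDiffOn_prolongCoeff (hB : IsOpen B) (hξ : ContDiffOn ℝ ∞ ξ B)
    (hφ : ContDiffOn ℝ ∞ φ B) (i : ℕ) : ContDiffOn ℝ ∞ (prolongCoeff ξ φ i) (jetsOver B i) := by
  induction i with
  | zero => exact hφ
  | succ i ih =>
    refine (contDiffOn_totalD hB ih).sub (ContDiffOn.mul ?_ ?_)
    · exact (by fun_prop : ContDiff ℝ ∞ fun z : Jet (i + 1) => z.2 (Fin.last (i + 1))).contDiffOn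
    · have h : ContDiffOn ℝ ∞ (totalD ξ) (jetsOver B (0 + 1)) := contDiffOn_totalD hB hξ
      exact h.comp (contDiff_trunc _).contDiffOn fun z hz => hz

theorem contDiffOn_prolong (hB : IsOpen B) (hξ : ContDiffOn ℝ ∞ ξ B)
    (hφ : ContDiffOn ℝ ∞ φ B) (m : ℕ) : ContDiffOn ℝ ∞ (prolong ξ φ m) (jetsOver B m) := by
  refine ContDiffOn.prodMk ?_ (contDiffOn_pi.2 fun j => ?_)
  · exact hξ.comp (contDiff_trunc _).contDiffOn fun z hz => hz
  · exact (contDiffOn_prolongCoeff hB hξ hφ j).comp (contDiff_trunc _).contDiffOn fun z hz => hz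

theorem prolongCoeff_zero (i : ℕ) : prolongCoeff (fun _ => 0) (fun _ => 0) i = fun _ => 0 := by
  induction i with
  | zero => rfl
  | succ i ih =>
    funext z
    simp [prolongCoeff, ih, totalD]

/-- For the choice `X₁ = 0`, the discrete operator `X₁^Δ` therefore moves only the steps, through
`σ₁`. -/
theorem prolong_zero (z : Jet m) : prolong (fun _ => 0) (fun _ => 0) m z = 0 := by
  unfold prolong
  simp only [prolongCoeff_zero]
  rfl

end Jets

/-! ### The discrete variables, the grid relations and the operators on them -/

section States

variable {N p : ℕ}

/-- The jet of order `k` at a node. -/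
def nodeJet (k : ℕ) (hk : k ≤ 2 * p) (α : Fin (N + 1)) : State N p →L[ℝ] Jet k :=
  (truncL k hk).comp ((ContinuousLinearMap.proj α).comp (ContinuousLinearMap.fst ℝ _ _))

theorem nodeJet_apply {k : ℕ} (hk : k ≤ 2 * p) (α : Fin (N + 1)) (s : State N p) :
    nodeJet k hk α s = (s.1 α).trunc k hk := rfl

/-- A step size. -/
def stepL (i : Fin N) : State N p →L[ℝ] ℝ :=
  (ContinuousLinearMap.proj i).comp (ContinuousLinearMap.snd ℝ _ _)

/-- A derivative at a node. -/
def coordL (α : Fin (N + 1)) (j : Fin (2 * p + 1)) : State N p →L[ℝ] ℝ :=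
  ((ContinuousLinearMap.proj (R := ℝ) (φ := fun _ => ℝ) j).comp
    (ContinuousLinearMap.snd ℝ ℝ (Fin (2 * p + 1) → ℝ))).comp
    ((ContinuousLinearMap.proj α).comp (ContinuousLinearMap.fst ℝ _ _))

/-- The independent variable at a node. -/
def abscissaL (α : Fin (N + 1)) : State N p →L[ℝ] ℝ :=
  (ContinuousLinearMap.fst ℝ _ _).comp
    ((ContinuousLinearMap.proj α).comp (ContinuousLinearMap.fst ℝ _ _))

/-! ### The grid relations -/

/-- The terms of order zero of the grid relations; `none` stands for the relation between the
independent variables, `some J` for the relation between the derivatives of order `J`. -/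
def gridA : Fin N × Option (Fin (p + 1)) → State N p →L[ℝ] ℝ
  | (i, none) => abscissaL i.succ - abscissaL i.castSucc
  | (i, some J) => coordL i.succ (Fin.castLE (by omega) J)
      - coordL i.castSucc (Fin.castLE (by omega) J)

/-- The terms of first order in `ε` of the grid relations. -/
def gridB (hp : 1 ≤ p) : Fin N × Option (Fin (p + 1)) → State N p → ℝ
  | (i, none) => fun s => - stepL i s
  | (i, some J) => fun s => - (stepL i s * coordL i.castSucc ⟨(J : ℕ) + 1, by omega⟩ s)

theorem contDiff_gridB (hp : 1 ≤ p) (c : Fin N × Option (Fin (p + 1))) :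
    ContDiff ℝ ∞ (gridB hp c : State N p → ℝ) := by
  rcases c with ⟨i, _ | J⟩ <;> unfold gridB <;> dsimp only <;> fun_prop

theorem gridA_eq_zero_iff {s : State N p} :
    (∀ c, gridA c s = 0) ↔ ∀ i : Fin N,
      nodeJet p (by omega) i.succ s = nodeJet p (by omega) i.castSucc s := by
  constructor
  · intro h i
    refine Prod.ext (sub_eq_zero.1 (h (i, none))) (funext fun J => ?_)
    exact sub_eq_zero.1 (h (i, some J))
  · rintro h ⟨i, _ | J⟩
    · have := congrArg Prod.fst (h i)
      exact sub_eq_zero.2 this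
    · have := congrFun (congrArg Prod.snd (h i)) J
      exact sub_eq_zero.2 this

/-- Induction along the grid. This lets `D ξ₀`, evaluated at different nodes for different steps,
become one common factor. -/
theorem nodeJet_eq_of_gridA_eq_zero {s : State N p} (hs : ∀ c, gridA c s = 0) {k : ℕ}
    (hk : k ≤ p) (α β : Fin (N + 1)) :
    nodeJet k (by omega) α s = nodeJet k (by omega) β s := by
  have h : ∀ α : Fin (N + 1), nodeJet p (by omega) α s = nodeJet p (by omega) 0 s := by
    intro α
    induction α using Fin.induction with
    | zero => rfl
    | succ i ih => rw [gridA_eq_zero_iff.1 hs i, ih]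
  exact congrArg (Jet.trunc k hk) ((h α).trans (h β).symm)

variable {n : ℕ} {hnp : n ≤ p} {B : Set (Jet 0)} {Ω : Set (Jet n)} {H : Set (Fin N → ℝ)}
  {ξ φ ξ₀ φ₀ : Jet 0 → ℝ}

theorem isOpen_stateDomain (hΩ : IsOpen Ω) (hH : IsOpen H) :
    IsOpen (stateDomain hnp Ω H) := by
  have : stateDomain hnp Ω H
      = (⋂ α, (nodeJet n (by omega) α : State N p →L[ℝ] Jet n) ⁻¹' Ω) ∩ Prod.snd ⁻¹' H := by
    ext s
    simp [stateDomain, nodeJet_apply]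
  rw [this]
  exact (isOpen_iInter_of_finite fun α => hΩ.preimage (nodeJet n _ α).continuous).inter
    (hH.preimage continuous_snd)

theorem nodeJet_mem_jetsOver (hΩB : ∀ z ∈ Ω, z.trunc 0 (Nat.zero_le n) ∈ B) {s : State N p}
    (hs : s ∈ stateDomain hnp Ω H) {k : ℕ} (hk : k ≤ 2 * p) (α : Fin (N + 1)) :
    nodeJet k hk α s ∈ jetsOver B k := hΩB _ (hs.1 α)

theorem contDiffOn_comp_nodeJet {G : Type*} [NormedAddCommGroup G] [NormedSpace ℝ G]
    (hΩB : ∀ z ∈ Ω, z.trunc 0 (Nat.zero_le n) ∈ B) {k : ℕ} (hk : k ≤ 2 * p)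
    {g : Jet k → G} (hg : ContDiffOn ℝ ∞ g (jetsOver B k)) (α : Fin (N + 1)) :
    ContDiffOn ℝ ∞ (fun s : State N p => g (nodeJet k hk α s)) (stateDomain hnp Ω H) :=
  hg.comp (nodeJet k hk α).contDiff.contDiffOn fun _ hs => nodeJet_mem_jetsOver hΩB hs hk α

theorem contDiffOn_discreteX₀ (hp : 1 ≤ p) (hB : IsOpen B)
    (hΩB : ∀ z ∈ Ω, z.trunc 0 (Nat.zero_le n) ∈ B)
    (hξ : ContDiffOn ℝ ∞ ξ B) (hφ : ContDiffOn ℝ ∞ φ B) :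
    ContDiffOn ℝ ∞ (discreteX₀ hp ξ φ : State N p → State N p) (stateDomain hnp Ω H) := by
  refine ContDiffOn.prodMk (contDiffOn_pi.2 fun α => ?_) (contDiffOn_pi.2 fun i => ?_)
  · exact contDiffOn_comp_nodeJet hΩB le_rfl (contDiffOn_prolong hB hξ hφ (2 * p)) α
  · exact (stepL i).contDiff.contDiffOn.mul (contDiffOn_comp_nodeJet (k := 0 + 1) hΩB (by omega)
      (contDiffOn_totalD hB hξ) i.castSucc)

theorem contDiffOn_discreteX₁ (hp : 1 ≤ p) (hB : IsOpen B)
    (hΩB : ∀ z ∈ Ω, z.trunc 0 (Nat.zero_le n) ∈ B) (hξ₀ : ContDiffOn ℝ ∞ ξ₀ B)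
    (hξ : ContDiffOn ℝ ∞ ξ B) (hφ : ContDiffOn ℝ ∞ φ B) :
    ContDiffOn ℝ ∞ (discreteX₁ hp ξ₀ ξ φ : State N p → State N p) (stateDomain hnp Ω H) := by
  refine ContDiffOn.prodMk (contDiffOn_pi.2 fun α => ?_)
    (contDiffOn_pi.2 fun i => ContDiffOn.add ?_ ?_)
  · exact contDiffOn_comp_nodeJet hΩB le_rfl (contDiffOn_prolong hB hξ hφ (2 * p)) α
  · exact (stepL i).contDiff.contDiffOn.mul (contDiffOn_comp_nodeJet (k := 0 + 1) hΩB (by omega)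
      (contDiffOn_totalD hB hξ) i.castSucc)
  · exact (((stepL i).contDiff.contDiffOn.pow 2).div_const 2).mul
      (contDiffOn_comp_nodeJet (k := 0 + 1 + 1) hΩB (by omega)
        (contDiffOn_totalD hB (contDiffOn_totalD hB hξ₀)) i.castSucc)

/-- A prolongation coefficient of order `j` depends only on the `j`-jet, so prolongation commutes
with truncation: the `k`-jet of a node evolves autonomously. -/
theorem nodeJet_discreteX₀ (hp : 1 ≤ p) {k : ℕ} (hk : k ≤ 2 * p) (α : Fin (N + 1))
    (s : State N p) :
    nodeJet k hk α (discreteX₀ hp ξ φ s) = prolong ξ φ k (nodeJet k hk α s) := rfl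

theorem nodeJet_discreteX₁ (hp : 1 ≤ p) {k : ℕ} (hk : k ≤ 2 * p) (α : Fin (N + 1))
    (s : State N p) :
    nodeJet k hk α (discreteX₁ hp ξ₀ ξ φ s) = prolong ξ φ k (nodeJet k hk α s) := rfl

theorem isLittleO_discreteSystem_iff (hp : 1 ≤ p) {F : Jet n → ℝ}
    {L1 : Fin (N + 1) → Jet p → (Fin N → ℝ) → ℝ} {α : Fin (N + 1)} {z : ℝ → State N p} :
    ((fun ε : ℝ => discreteSystem hnp hp F L1 α (z ε) ε) =o[𝓝[>] 0] fun ε : ℝ => ε) ↔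
      ((fun ε : ℝ => F (nodeJet n (by omega) α (z ε))
        + ε * L1 α (nodeJet p (by omega) α (z ε)) (z ε).2) =o[𝓝[>] 0] fun ε : ℝ => ε) ∧
      ((fun (ε : ℝ) c => gridA c (z ε) + ε * gridB hp c (z ε)) =o[𝓝[>] 0] fun ε : ℝ => ε) := by
  simp only [discreteSystem, isLittleO_prod_left, isLittleO_pi, nodeJet_apply]
  refine and_congr Iff.rfl ⟨?_, fun h => ⟨fun i => ?_, fun i J => ?_⟩⟩
  · rintro ⟨h1, h2⟩ ⟨i, _ | J⟩
    · exact (h1 i).congr_left fun ε => by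
        simp [gridA, gridB, abscissaL, stepL]
        ring
    · exact (h2 i J).congr_left fun ε => by
        simp [gridA, gridB, coordL, stepL]
        ring
  · exact (h (i, none)).congr_left fun ε => by
      simp [gridA, gridB, abscissaL, stepL]
      ring
  · exact (h (i, some J)).congr_left fun ε => by
      simp [gridA, gridB, coordL, stepL]
      ring

end States

/-! ### Homogeneity of the first differential approximation in the steps -/

section Homogeneity

variable {N n p : ℕ} {hnp : n ≤ p} {Ω : Set (Jet n)} {H : Set (Fin N → ℝ)} {F : Jet n → ℝ}
  {L : Fin (N + 1) → (Fin (N + 1) → ℝ) → (Fin (N + 1) → ℝ) → ℝ}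
  {L1 : Fin (N + 1) → Jet p → (Fin N → ℝ) → ℝ} {ξ₀ φ₀ : Jet 0 → ℝ}

theorem stepSum_smul (t : ℝ) (h : Fin N → ℝ) (β α : Fin (N + 1)) :
    stepSum (t • h) β α = t * stepSum h β α := by
  simp only [stepSum, mul_sub, Finset.mul_sum, Pi.smul_apply, smul_eq_mul, mul_ite, mul_zero]

/-- The first differential approximation is homogeneous of degree one in the steps. -/
theorem IsFirstDifferentialApproximation.map_smul
    (happrox : IsFirstDifferentialApproximation hnp Ω H F L L1)
    (hHcone : ∀ h ∈ H, ∀ t : ℝ, 0 < t → t • h ∈ H) (α : Fin (N + 1)) {z : Jet p}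
    {h : Fin N → ℝ} (hz : z.trunc n hnp ∈ Ω) (hh : h ∈ H) {t : ℝ} (ht : 0 < t) :
    L1 α z (t • h) = t * L1 α z h := by
  have h1 := happrox α z (t • h) hz (hHcone h hh t ht)
  -- Steps `t h` with parameter `ε` give the same substitution in `L` as steps `h` with parameter `ε
  -- t`, so the two expansions can be compared.
  have htend : Tendsto (fun ε : ℝ => ε * t) (𝓝[>] 0) (𝓝[>] 0) := by
    refine tendsto_nhdsWithin_iff.2 ⟨?_, ?_⟩
    · exact (Continuous.tendsto' (by fun_prop) 0 0 (by simp)).mono_left nhdsWithin_le_nhds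
    · filter_upwards [self_mem_nhdsWithin] with ε hε using mul_pos hε ht
  have h2 := ((happrox α z h hz hh).comp_tendsto htend).trans_isBigO
    (k := fun ε : ℝ => ε) (by
      simpa [Function.comp_def, mul_comm] using isBigO_const_mul_self t (fun ε : ℝ => ε) (𝓝[>] 0))
  have h3 := h2.sub h1
  have h4 : (fun ε : ℝ => ε * (L1 α z (t • h) - t * L1 α z h)) =o[𝓝[>] 0] fun ε : ℝ => ε := by
    refine h3.congr_left fun ε => ?_
    simp only [Function.comp_def, stepSum_smul, ← mul_assoc]
    ring
  by_contra hne
  have hc : L1 α z (t • h) - t * L1 α z h ≠ 0 := sub_ne_zero.2 hne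
  have h5 : (fun ε : ℝ => ε) =o[𝓝[>] (0 : ℝ)] fun ε : ℝ => ε :=
    (h4.const_mul_left (L1 α z (t • h) - t * L1 α z h)⁻¹).congr_left fun ε => by field_simp
  have h6 := (isLittleO_irrefl' (f' := fun ε : ℝ => ε) (l := 𝓝[>] (0 : ℝ))
    (Eventually.frequently (by
      filter_upwards [self_mem_nhdsWithin] with ε (hε : 0 < ε)
      simpa using hε.ne')))
  exact h6 h5

theorem isOpen_setOf_trunc_mem (hΩ : IsOpen Ω) (hH : IsOpen H) :
    IsOpen {w : Jet p × (Fin N → ℝ) | w.1.trunc n hnp ∈ Ω ∧ w.2 ∈ H} :=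
  (hΩ.preimage ((continuous_trunc hnp).comp continuous_fst)).inter (hH.preimage continuous_snd)

/-- The derivative of a function that is homogeneous of degree one in the steps, when the steps are
scaled by `κ`. -/
theorem fderiv_apply_smul_steps (hΩ : IsOpen Ω) (hH : IsOpen H)
    (hHcone : ∀ h ∈ H, ∀ t : ℝ, 0 < t → t • h ∈ H)
    (hL1 : ∀ α, ContDiffOn ℝ ∞ (fun w : Jet p × (Fin N → ℝ) => L1 α w.1 w.2)
      {w | w.1.trunc n hnp ∈ Ω ∧ w.2 ∈ H})
    (happrox : IsFirstDifferentialApproximation hnp Ω H F L L1) (α : Fin (N + 1)) {z : Jet p}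
    {h : Fin N → ℝ} (hz : z.trunc n hnp ∈ Ω) (hh : h ∈ H) (v : Jet p) (κ : ℝ) :
    fderiv ℝ (fun w : Jet p × (Fin N → ℝ) => L1 α w.1 w.2) (z, h) (v, κ • h)
      = fderiv ℝ (fun w => L1 α w h) z v + κ * L1 α z h := by
  have hd : HasFDerivAt (fun w : Jet p × (Fin N → ℝ) => L1 α w.1 w.2)
      (fderiv ℝ (fun w : Jet p × (Fin N → ℝ) => L1 α w.1 w.2) (z, h)) (z, h) :=
    (((hL1 α).contDiffAt ((isOpen_setOf_trunc_mem hΩ hH).mem_nhds ⟨hz, hh⟩)).differentiableAt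
      (by simp)).hasFDerivAt
  set D := fderiv ℝ (fun w : Jet p × (Fin N → ℝ) => L1 α w.1 w.2) (z, h)
  have h1 : fderiv ℝ (fun w => L1 α w h) z v = D (v, 0) := by
    have hf : HasFDerivAt (fun w => L1 α w h) _ z :=
      HasFDerivAt.comp (g := fun w : Jet p × (Fin N → ℝ) => L1 α w.1 w.2) (f := fun w => (w, h)) z
        hd (hasFDerivAt_prodMk_left z h)
    simp [hf.fderiv]
  -- Euler's identity: `t ↦ L¹(z, t h)` is differentiated at `t = 1` by the chain rule and by
  -- homogeneity.
  have h2 : D (0, h) = L1 α z h := by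
    have e1 : HasDerivAt (fun t : ℝ => ((z, t • h) : Jet p × (Fin N → ℝ))) (0, h) 1 := by
      have := (hasDerivAt_const (1 : ℝ) z).prodMk ((hasDerivAt_id (1 : ℝ)).smul_const h)
      simpa using this
    have e2 : HasDerivAt (fun t : ℝ => L1 α z (t • h)) (D (0, h)) 1 :=
      HasFDerivAt.comp_hasDerivAt (l := fun w : Jet p × (Fin N → ℝ) => L1 α w.1 w.2)
        (f := fun t : ℝ => (z, t • h)) (1 : ℝ) (by simpa using hd) e1
    have e3 : HasDerivAt (fun t : ℝ => L1 α z (t • h)) (L1 α z h) 1 := by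
      have : HasDerivAt (fun t : ℝ => t * L1 α z h) (L1 α z h) 1 := by
        simpa using (hasDerivAt_id (1 : ℝ)).mul_const (L1 α z h)
      refine this.congr_of_eventuallyEq ?_
      filter_upwards [lt_mem_nhds zero_lt_one] with t ht
      exact happrox.map_smul hHcone α hz hh ht
    exact e2.unique e3
  have h3 : ((v, κ • h) : Jet p × (Fin N → ℝ)) = (v, 0) + κ • (0, h) := by simp
  rw [h3, map_add, _root_.map_smul, h1, h2, smul_eq_mul]

end Homogeneity

/-! ### Infinitesimal invariance of the grid relations -/

section Estimates

variable {N n p : ℕ}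

theorem eventually_abs_mul_le {α : Type*} {l : Filter (α × ℝ)} (hl : ∀ᶠ x in l, 0 < x.2)
    {r : α × ℝ → ℝ} (hr : Tendsto r l (𝓝 0)) {η : ℝ} (hη : 0 < η) :
    ∀ᶠ x in l, |x.2 * r x| ≤ η * x.2 := by
  have h1 : ∀ᶠ x in l, |r x| < η := by
    have := hr.abs
    rw [abs_zero] at this
    exact this.eventually_lt_const hη
  filter_upwards [hl, h1] with x h0 h1
  rw [abs_mul, abs_of_pos h0, mul_comm]
  gcongr

theorem eventually_snd_pos {α : Type*} [TopologicalSpace α] (w : α) :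
    ∀ᶠ x : α × ℝ in 𝓝 w ×ˢ 𝓝[>] 0, 0 < x.2 :=
  tendsto_snd.eventually self_mem_nhdsWithin

theorem tendsto_snd_zero {α : Type*} [TopologicalSpace α] (w : α) :
    Tendsto (fun x : α × ℝ => x.2) (𝓝 w ×ˢ 𝓝[>] 0) (𝓝 0) :=
  tendsto_snd.mono_right nhdsWithin_le_nhds

/-- The left-hand sides of the grid relations. -/
def gridLHS (hp : 1 ≤ p) (s : State N p) (ε : ℝ) (c : Fin N × Option (Fin (p + 1))) : ℝ :=
  gridA c s + ε * gridB hp c s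

/-- In the sup norm, each component on the left is itself the left-hand side of a grid relation, as
`k ≤ p`. -/
theorem norm_nodeJet_sub_le (hp : 1 ≤ p) {k : ℕ} (hk : k ≤ p) (i : Fin N) (s : State N p)
    (ε : ℝ) :
    ‖nodeJet k (by omega) i.succ s - nodeJet k (by omega) i.castSucc s
      - (ε * stepL i s) • jetShift (nodeJet (k + 1) (by omega) i.castSucc s)‖
      ≤ ‖gridLHS hp s ε‖ := by
  refine max_le ?_ ((pi_norm_le_iff_of_nonneg (norm_nonneg _)).2 fun j => ?_)
  · refine le_of_eq_of_le (congrArg norm ?_) (norm_le_pi_norm (gridLHS hp s ε) (i, none))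
    change (s.1 i.succ).1 - (s.1 i.castSucc).1 - ε * s.2 i * 1
      = (s.1 i.succ).1 - (s.1 i.castSucc).1 + ε * -s.2 i
    ring
  · refine le_of_eq_of_le (congrArg norm ?_)
      (norm_le_pi_norm (gridLHS hp s ε) (i, some (Fin.castLE (by omega) j)))
    change (s.1 i.succ).2 _ - (s.1 i.castSucc).2 _ - ε * s.2 i * (s.1 i.castSucc).2 _
      = (s.1 i.succ).2 _ - (s.1 i.castSucc).2 _ + ε * -(s.2 i * (s.1 i.castSucc).2 _)
    rw [mul_neg, ← sub_eq_add_neg, mul_assoc]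
    rfl

/-- The increment of a function of the jets between neighbouring nodes is `ε h D g`, up to the
grid relations. -/
theorem eventually_abs_increment_sub_le (hp : 1 ≤ p) {k : ℕ} (hk : k ≤ p) {g : Jet k → ℝ}
    (i : Fin N) {w : State N p} (hg : ContDiffAt ℝ 1 g (nodeJet k (by omega) i.castSucc w))
    (hw : nodeJet k (by omega) i.succ w = nodeJet k (by omega) i.castSucc w) {η : ℝ}
    (hη : 0 < η) :
    ∀ᶠ x : State N p × ℝ in 𝓝 w ×ˢ 𝓝[>] 0,
      |g (nodeJet k (by omega) i.succ x.1) - g (nodeJet k (by omega) i.castSucc x.1)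
          - x.2 * (stepL i x.1 * totalD g (nodeJet (k + 1) (by omega) i.castSucc x.1))|
        ≤ (‖fderiv ℝ g (nodeJet k (by omega) i.castSucc w)‖ + 1) * ‖gridLHS hp x.1 x.2‖
          + η * x.2 := by
  set P := nodeJet k (by omega) i.castSucc w with hP
  set l : Filter (State N p × ℝ) := 𝓝 w ×ˢ 𝓝[>] 0 with hl
  set b : State N p → Jet k := fun s => stepL i s • jetShift (nodeJet (k + 1) (by omega)
    i.castSucc s) with hb
  have t0 : Tendsto (fun x : State N p × ℝ => x.1) l (𝓝 w) := tendsto_fst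
  have t1 : Tendsto (fun x : State N p × ℝ => nodeJet k (by omega) i.castSucc x.1) l (𝓝 P) :=
    ((nodeJet k (by omega) i.castSucc).continuous.tendsto w).comp t0
  have t2 : Tendsto (fun x : State N p × ℝ => nodeJet k (by omega) i.succ x.1) l (𝓝 P) := by
    have := ((nodeJet k (by omega) i.succ).continuous.tendsto w).comp t0
    rwa [hw] at this
  have hbc : Continuous b := (stepL i).continuous.smul
    (contDiff_jetShift.continuous.comp (nodeJet (k + 1) (by omega) i.castSucc).continuous)
  have t3 : Tendsto (fun x : State N p × ℝ => b x.1) l (𝓝 (b w)) := (hbc.tendsto w).comp t0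
  set C := ‖b w‖ + 1 with hC
  have hC0 : 0 < C := by positivity
  have ev1 : ∀ᶠ x in l, ‖b x.1‖ ≤ C :=
    (t3.norm.eventually_lt_const (lt_add_one _)).mono fun x hx => hx.le
  -- The linearisation error is at most `ρ (Γ + ε C)`, where `Γ` is the grid error: `ρ ≤ 1` yields
  -- the summand `1` in the constant, and the second bound yields `η / 2 * ε`.
  set ρ := min 1 (η / 2 / C) with hρ
  have hρ0 : 0 < ρ := lt_min one_pos (by positivity)
  have hstrict := (hg.hasStrictFDerivAt one_ne_zero).isLittleO.comp_tendsto (t2.prodMk_nhds t1)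
  have hfd : Tendsto (fun x : State N p × ℝ => fderiv ℝ g (nodeJet k (by omega) i.castSucc x.1)) l
      (𝓝 (fderiv ℝ g P)) := (hg.continuousAt_fderiv one_ne_zero).tendsto.comp t1
  have t4 : Tendsto (fun x : State N p × ℝ => fderiv ℝ g P (b x.1)
      - fderiv ℝ g (nodeJet k (by omega) i.castSucc x.1) (b x.1)) l (𝓝 0) := by
    have e1 := (isBoundedBilinearMap_apply.continuous.tendsto
      (fderiv ℝ g P, b w)).comp (hfd.prodMk_nhds t3)
    have e2 := (((fderiv ℝ g P).continuous.tendsto _).comp t3).sub e1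
    simpa [Function.comp_def] using e2
  filter_upwards [hstrict.def hρ0, ev1, eventually_snd_pos w,
    eventually_abs_mul_le (eventually_snd_pos w) t4 (half_pos hη)] with x h1 h2 h3 h4
  simp only [Function.comp_def] at h1
  have hδ := norm_nodeJet_sub_le hp hk i x.1 x.2
  rw [mul_smul] at hδ
  change ‖_ - _ - x.2 • b x.1‖ ≤ _ at hδ
  have hD : stepL i x.1 * totalD g (nodeJet (k + 1) (by omega) i.castSucc x.1)
      = fderiv ℝ g (nodeJet k (by omega) i.castSucc x.1) (b x.1) := by
    rw [hb, _root_.map_smul, smul_eq_mul]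
    rfl
  rw [hD]
  generalize nodeJet k (by omega) i.castSucc x.1 = Q at *
  generalize nodeJet k (by omega) i.succ x.1 = Q' at *
  generalize ‖gridLHS hp x.1 x.2‖ = Γ at *
  have hQ : ‖Q' - Q‖ ≤ Γ + x.2 * C := by
    have : Q' - Q = (Q' - Q - x.2 • b x.1) + x.2 • b x.1 := by abel
    rw [this]
    refine (norm_add_le _ _).trans (add_le_add hδ ?_)
    rw [norm_smul, Real.norm_eq_abs, abs_of_pos h3]
    gcongr
  have hΓ : 0 ≤ Γ := (norm_nonneg _).trans hδ
  have hd1 : |fderiv ℝ g P (Q' - Q - x.2 • b x.1)| ≤ ‖fderiv ℝ g P‖ * Γ :=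
    ((fderiv ℝ g P).le_opNorm _).trans (by gcongr)
  have hs1 : ρ * ‖Q' - Q‖ ≤ Γ + η / 2 * x.2 := by
    have e1 : ρ * Γ ≤ 1 * Γ := by gcongr; exact min_le_left _ _
    have e2 : ρ * (x.2 * C) ≤ η / 2 / C * (x.2 * C) := by gcongr; exact min_le_right _ _
    have e3 : η / 2 / C * (x.2 * C) = η / 2 * x.2 := by field_simp
    have e4 : ρ * ‖Q' - Q‖ ≤ ρ * (Γ + x.2 * C) := by gcongr
    linarith
  -- The three terms are the linearisation error at the limit point `P`, the grid error, and the
  -- change of base point from `P` to `Q`.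
  have hsplit : g Q' - g Q - x.2 * fderiv ℝ g Q (b x.1)
      = (g Q' - g Q - fderiv ℝ g P (Q' - Q)) + fderiv ℝ g P (Q' - Q - x.2 • b x.1)
        + x.2 * (fderiv ℝ g P (b x.1) - fderiv ℝ g Q (b x.1)) := by
    simp only [map_sub, _root_.map_smul, smul_eq_mul]
    ring
  rw [hsplit]
  refine (abs_add_three _ _ _).trans ?_
  rw [Real.norm_eq_abs] at h1
  linarith

/-- The norm of the differential of the prolongation coefficient that belongs to a grid relation. -/
def gridGradNorm (ξ φ : Jet 0 → ℝ) : Fin N × Option (Fin (p + 1)) → State N p → ℝ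
  | (i, none) => fun s => ‖fderiv ℝ ξ (nodeJet 0 (by omega) i.castSucc s)‖
  | (i, some J) => fun s => ‖fderiv ℝ (prolongCoeff ξ φ J) (nodeJet J (by omega) i.castSucc s)‖

variable {hnp : n ≤ p} {B : Set (Jet 0)} {Ω : Set (Jet n)} {H : Set (Fin N → ℝ)}
  {ξ₀ φ₀ ξ₁ φ₁ : Jet 0 → ℝ}

theorem continuousOn_gridGradNorm (hB : IsOpen B)
    (hΩB : ∀ z ∈ Ω, z.trunc 0 (Nat.zero_le n) ∈ B) (hξ₀ : ContDiffOn ℝ ∞ ξ₀ B)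
    (hφ₀ : ContDiffOn ℝ ∞ φ₀ B) (c : Fin N × Option (Fin (p + 1))) :
    ContinuousOn (gridGradNorm ξ₀ φ₀ c) (stateDomain hnp Ω H) := by
  rcases c with ⟨i, _ | J⟩
  · have h : ContDiffOn ℝ ∞ (fderiv ℝ ξ₀) (jetsOver B 0) := hξ₀.fderiv_of_isOpen hB (by simp)
    exact (contDiffOn_comp_nodeJet hΩB _ h _).continuousOn.norm
  · have h : ContDiffOn ℝ ∞ (fderiv ℝ (prolongCoeff ξ₀ φ₀ J)) (jetsOver B J) :=
      (contDiffOn_prolongCoeff hB hξ₀ hφ₀ J).fderiv_of_isOpen (isOpen_jetsOver hB) (by simp)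
    exact (contDiffOn_comp_nodeJet hΩB _ h _).continuousOn.norm

theorem gridA_discreteX₁_zero (hp : 1 ≤ p) (c : Fin N × Option (Fin (p + 1))) (s : State N p) :
    gridA c (discreteX₁ hp ξ₀ (fun _ => 0) (fun _ => 0) s) = 0 := by
  refine gridA_eq_zero_iff.2 (fun i => ?_) c
  rw [nodeJet_discreteX₁, nodeJet_discreteX₁, prolong_zero, prolong_zero]

/-- Infinitesimal invariance of the grid relations. -/
theorem eventually_abs_deriv_grid_le (hp : 1 ≤ p) (hB : IsOpen B) (hΩ : IsOpen Ω)
    (hH : IsOpen H) (hΩB : ∀ z ∈ Ω, z.trunc 0 (Nat.zero_le n) ∈ B)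
    (hξ₀ : ContDiffOn ℝ ∞ ξ₀ B) (hφ₀ : ContDiffOn ℝ ∞ φ₀ B) {w : State N p}
    (hw : w ∈ stateDomain hnp Ω H) (hw0 : ∀ c, gridA c w = 0)
    (c : Fin N × Option (Fin (p + 1))) {η : ℝ} (hη : 0 < η) :
    ∀ᶠ x : State N p × ℝ in 𝓝 w ×ˢ 𝓝[>] 0,
      |fderiv ℝ (gridA c) x.1 (discreteX₀ hp ξ₀ φ₀ x.1
            + x.2 • discreteX₁ hp ξ₀ (fun _ => 0) (fun _ => 0) x.1)
          + x.2 * fderiv ℝ (gridB hp c) x.1 (discreteX₀ hp ξ₀ φ₀ x.1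
            + x.2 • discreteX₁ hp ξ₀ (fun _ => 0) (fun _ => 0) x.1)|
        ≤ (gridGradNorm ξ₀ φ₀ c w + 1) * ‖gridLHS hp x.1 x.2‖ + η * x.2 := by
  have hU : stateDomain hnp Ω H ∈ 𝓝 w := (isOpen_stateDomain hΩ hH).mem_nhds hw
  have hX₁ : ContinuousAt (discreteX₁ hp ξ₀ (fun _ => 0) (fun _ => 0) : State N p → _) w :=
    (contDiffOn_discreteX₁ hp hB hΩB hξ₀ contDiffOn_const contDiffOn_const
      ).continuousOn.continuousAt hU
  have t0 : Tendsto (fun x : State N p × ℝ => x.1) (𝓝 w ×ˢ 𝓝[>] 0) (𝓝 w) := tendsto_fst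
  -- Multiplied by the remaining `ε`, this is the whole contribution of `σ₁`, hence negligible.
  have hquad : Tendsto (fun x : State N p × ℝ => x.2 * fderiv ℝ (gridB hp c) x.1
      (discreteX₁ hp ξ₀ (fun _ => 0) (fun _ => 0) x.1)) (𝓝 w ×ˢ 𝓝[>] 0) (𝓝 0) := by
    have e1 : ContinuousAt (fun s => fderiv ℝ (gridB hp c) s
        (discreteX₁ hp ξ₀ (fun _ => 0) (fun _ => 0) s)) w :=
      (((contDiff_gridB hp c).continuous_fderiv (by simp)).continuousAt).clm_apply hX₁
    simpa using (tendsto_snd_zero w).mul (e1.tendsto.comp t0)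
  have hincr : ∀ᶠ x : State N p × ℝ in 𝓝 w ×ˢ 𝓝[>] 0,
      |gridA c (discreteX₀ hp ξ₀ φ₀ x.1)
          + x.2 * fderiv ℝ (gridB hp c) x.1 (discreteX₀ hp ξ₀ φ₀ x.1)|
        ≤ (gridGradNorm ξ₀ φ₀ c w + 1) * ‖gridLHS hp x.1 x.2‖ + η / 2 * x.2 := by
    rcases c with ⟨i, _ | J⟩
    · have hg : ContDiffAt ℝ 1 ξ₀ (nodeJet 0 (by omega) i.castSucc w) :=
        ((hξ₀.contDiffAt (hB.mem_nhds (nodeJet_mem_jetsOver hΩB hw (by omega) _))).of_le (by simp))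
      filter_upwards [eventually_abs_increment_sub_le hp (Nat.zero_le p) i hg
        (nodeJet_eq_of_gridA_eq_zero hw0 (Nat.zero_le p) _ _) (half_pos hη)] with x hx
      have hB' : fderiv ℝ (gridB hp (i, none)) x.1 = -stepL i := (-stepL i).fderiv
      rw [hB']
      refine le_of_eq_of_le (congrArg abs ?_) hx
      change ξ₀ _ - ξ₀ _ + x.2 * -(x.1.2 i * totalD ξ₀ _) = _
      rw [mul_neg, ← sub_eq_add_neg]
      rfl
    · have hg : ContDiffAt ℝ 1 (prolongCoeff ξ₀ φ₀ J) (nodeJet J (by omega) i.castSucc w) :=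
        (((contDiffOn_prolongCoeff hB hξ₀ hφ₀ J).contDiffAt ((isOpen_jetsOver hB).mem_nhds
          (nodeJet_mem_jetsOver hΩB hw (by omega) _))).of_le (by simp))
      filter_upwards [eventually_abs_increment_sub_le hp (Nat.lt_succ_iff.1 J.2) i hg
        (nodeJet_eq_of_gridA_eq_zero hw0 (Nat.lt_succ_iff.1 J.2) _ _) (half_pos hη)] with x hx
      have hB' : fderiv ℝ (gridB hp (i, some J)) x.1 (discreteX₀ hp ξ₀ φ₀ x.1)
          = -(x.1.2 i * totalD (prolongCoeff ξ₀ φ₀ J)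
            (nodeJet (J + 1) (by omega) i.castSucc x.1)) := by
        have : HasFDerivAt (gridB hp (i, some J) : State N p → ℝ) _ x.1 :=
          ((stepL i).hasFDerivAt.mul (coordL i.castSucc ⟨(J : ℕ) + 1, by omega⟩).hasFDerivAt).neg
        rw [this.fderiv]
        -- The term `-y⁽ᴶ⁺¹⁾ D ξ₀` of the prolongation cancels the change of the step under `σ₀`,
        -- leaving `h D φ⁽ᴶ⁾`.
        change -(x.1.2 i * (totalD (prolongCoeff ξ₀ φ₀ J) _
          - (x.1.1 i.castSucc).2 _ * totalD ξ₀ _) + (x.1.1 i.castSucc).2 _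
            * (x.1.2 i * totalD ξ₀ _)) = _
        have key : ∀ a b c d : ℝ, -(a * (b - c * d) + c * (a * d)) = -(a * b) := by
          intros
          ring
        exact key _ _ _ _
      rw [hB']
      refine le_of_eq_of_le (congrArg abs ?_) hx
      rw [mul_neg, ← sub_eq_add_neg]
      rfl
  filter_upwards [hincr, eventually_abs_mul_le (eventually_snd_pos w) hquad (half_pos hη)]
    with x h1 h2
  have hsplit : fderiv ℝ (gridA c) x.1 (discreteX₀ hp ξ₀ φ₀ x.1
            + x.2 • discreteX₁ hp ξ₀ (fun _ => 0) (fun _ => 0) x.1)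
          + x.2 * fderiv ℝ (gridB hp c) x.1 (discreteX₀ hp ξ₀ φ₀ x.1
            + x.2 • discreteX₁ hp ξ₀ (fun _ => 0) (fun _ => 0) x.1)
      = (gridA c (discreteX₀ hp ξ₀ φ₀ x.1)
          + x.2 * fderiv ℝ (gridB hp c) x.1 (discreteX₀ hp ξ₀ φ₀ x.1))
        + x.2 * (x.2 * fderiv ℝ (gridB hp c) x.1
          (discreteX₁ hp ξ₀ (fun _ => 0) (fun _ => 0) x.1)) := by
    rw [ContinuousLinearMap.fderiv]
    simp only [map_add, _root_.map_smul, smul_eq_mul, gridA_discreteX₁_zero]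
    ring
  rw [hsplit]
  refine (abs_add_le _ _).trans ?_
  linarith

end Estimates

/-! ### The rate of change of the difference equation at a node -/

section Equation

variable {N n p : ℕ} {B : Set (Jet 0)} {Ω : Set (Jet n)}
  {H : Set (Fin N → ℝ)} {F lam : Jet n → ℝ} {L1 : Fin (N + 1) → Jet p → (Fin N → ℝ) → ℝ}
  {ξ₀ φ₀ ξ₁ φ₁ : Jet 0 → ℝ}

/-- The differential equation at a node. -/
def eqnA (hnp : n ≤ p) (F : Jet n → ℝ) (α : Fin (N + 1)) (s : State N p) : ℝ :=
  F (nodeJet n (by omega) α s)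

/-- The term of first order in `ε` of the difference equation at a node. -/
def eqnB (L1 : Fin (N + 1) → Jet p → (Fin N → ℝ) → ℝ) (α : Fin (N + 1)) (s : State N p) : ℝ :=
  L1 α (nodeJet p (by omega) α s) s.2

/-- The derivative of the equation at a node along the operator is `λ` times its left-hand side plus
`ε` times this rate, up to `o(ε)`. -/
def eqnRate (hnp : n ≤ p) (hp : 1 ≤ p) (F lam : Jet n → ℝ)
    (L1 : Fin (N + 1) → Jet p → (Fin N → ℝ) → ℝ)
    (ξ₀ φ₀ ξ₁ φ₁ : Jet 0 → ℝ) (α : Fin (N + 1)) (s : State N p) : ℝ :=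
  applyOp ξ₁ φ₁ F (nodeJet n (by omega) α s)
    + fderiv ℝ (eqnB L1 α) s (discreteX₀ hp ξ₀ φ₀ s)
    - lam (nodeJet n (by omega) α s) * eqnB L1 α s

variable (hnp : n ≤ p)

theorem contDiffOn_eqnA (hF : ContDiffOn ℝ ∞ F Ω) (α : Fin (N + 1)) :
    ContDiffOn ℝ ∞ (eqnA hnp F α : State N p → ℝ) (stateDomain hnp Ω H) :=
  hF.comp (nodeJet n _ α).contDiff.contDiffOn fun _ hs => hs.1 α

theorem contDiffOn_eqnB (hL1 : ∀ α, ContDiffOn ℝ ∞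
      (fun w : Jet p × (Fin N → ℝ) => L1 α w.1 w.2) {w | w.1.trunc n hnp ∈ Ω ∧ w.2 ∈ H})
    (α : Fin (N + 1)) :
    ContDiffOn ℝ ∞ (eqnB L1 α : State N p → ℝ) (stateDomain hnp Ω H) :=
  (hL1 α).comp ((nodeJet p _ α).prod (ContinuousLinearMap.snd ℝ _ _)).contDiff.contDiffOn
    fun _ hs => ⟨hs.1 α, hs.2⟩

theorem fderiv_eqnA (hΩ : IsOpen Ω) (hF : ContDiffOn ℝ ∞ F Ω) (α : Fin (N + 1)) {s : State N p}
    (hs : s ∈ stateDomain hnp Ω H) (v : State N p) :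
    fderiv ℝ (eqnA hnp F α) s v
      = fderiv ℝ F (nodeJet n (by omega) α s) (nodeJet n (by omega) α v) := by
  have h1 : DifferentiableAt ℝ F (nodeJet n (by omega) α s) :=
    (hF.contDiffAt (hΩ.mem_nhds (hs.1 α))).differentiableAt (by simp)
  have h2 : HasFDerivAt (eqnA hnp F α) _ s :=
    h1.hasFDerivAt.comp s (nodeJet n (by omega) α).hasFDerivAt
  rw [h2.fderiv]
  rfl

variable {hnp} {hp : 1 ≤ p}

theorem continuousOn_eqnRate (hB : IsOpen B) (hΩ : IsOpen Ω) (hH : IsOpen H)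
    (hΩB : ∀ z ∈ Ω, z.trunc 0 (Nat.zero_le n) ∈ B) (hF : ContDiffOn ℝ ∞ F Ω)
    (hL1 : ∀ α, ContDiffOn ℝ ∞
      (fun w : Jet p × (Fin N → ℝ) => L1 α w.1 w.2) {w | w.1.trunc n hnp ∈ Ω ∧ w.2 ∈ H})
    (hξ₀ : ContDiffOn ℝ ∞ ξ₀ B) (hφ₀ : ContDiffOn ℝ ∞ φ₀ B) (hξ₁ : ContDiffOn ℝ ∞ ξ₁ B)
    (hφ₁ : ContDiffOn ℝ ∞ φ₁ B) (hlam : ContDiffOn ℝ ∞ lam Ω) (α : Fin (N + 1)) :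
    ContinuousOn (eqnRate hnp hp F lam L1 ξ₀ φ₀ ξ₁ φ₁ α) (stateDomain hnp Ω H) := by
  have hn : MapsTo (nodeJet n (by omega) α : State N p → Jet n) (stateDomain hnp Ω H) Ω :=
    fun s hs => hs.1 α
  have hnc := (nodeJet (N := N) n (show n ≤ 2 * p by omega) α).continuous.continuousOn
    (s := stateDomain hnp Ω H)
  have h1 : ContinuousOn (applyOp ξ₁ φ₁ F) Ω :=
    (hF.continuousOn_fderiv_of_isOpen hΩ (by simp)).clm_apply
      ((contDiffOn_prolong hB hξ₁ hφ₁ n).continuousOn.mono hΩB)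
  have h2 : ContinuousOn (fun s : State N p => fderiv ℝ (eqnB L1 α) s (discreteX₀ hp ξ₀ φ₀ s))
      (stateDomain hnp Ω H) :=
    ((contDiffOn_eqnB hnp hL1 α).continuousOn_fderiv_of_isOpen (isOpen_stateDomain hΩ hH)
      (by simp)).clm_apply (contDiffOn_discreteX₀ hp hB hΩB hξ₀ hφ₀).continuousOn
  exact ((h1.comp hnc hn).add h2).sub
    ((hlam.continuousOn.comp hnc hn).mul (contDiffOn_eqnB hnp hL1 α).continuousOn)

/-- The derivative of the equation at a node along the operator. -/
theorem eventually_abs_deriv_eqn_le (hB : IsOpen B) (hΩ : IsOpen Ω) (hH : IsOpen H)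
    (hΩB : ∀ z ∈ Ω, z.trunc 0 (Nat.zero_le n) ∈ B) (hF : ContDiffOn ℝ ∞ F Ω)
    (hL1 : ∀ α, ContDiffOn ℝ ∞
      (fun w : Jet p × (Fin N → ℝ) => L1 α w.1 w.2) {w | w.1.trunc n hnp ∈ Ω ∧ w.2 ∈ H})
    (hξ₀ : ContDiffOn ℝ ∞ ξ₀ B) (hφ₀ : ContDiffOn ℝ ∞ φ₀ B) (hξ₁ : ContDiffOn ℝ ∞ ξ₁ B)
    (hφ₁ : ContDiffOn ℝ ∞ φ₁ B) (hlam : ContDiffOn ℝ ∞ lam Ω)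
    (hsym : ∀ z ∈ Ω, applyOp ξ₀ φ₀ F z = lam z * F z) (α : Fin (N + 1)) {w : State N p}
    (hw : w ∈ stateDomain hnp Ω H) {η : ℝ} (hη : 0 < η) :
    ∀ᶠ x : State N p × ℝ in 𝓝 w ×ˢ 𝓝[>] 0,
      |fderiv ℝ (eqnA hnp F α) x.1
            (discreteX₀ hp ξ₀ φ₀ x.1 + x.2 • discreteX₁ hp ξ₀ ξ₁ φ₁ x.1)
          + x.2 * fderiv ℝ (eqnB L1 α) x.1
            (discreteX₀ hp ξ₀ φ₀ x.1 + x.2 • discreteX₁ hp ξ₀ ξ₁ φ₁ x.1)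
          - x.2 * eqnRate hnp hp F lam L1 ξ₀ φ₀ ξ₁ φ₁ α w|
        ≤ (|lam (nodeJet n (by omega) α w)| + 1) * |eqnA hnp F α x.1 + x.2 * eqnB L1 α x.1|
          + η * x.2 := by
  have hU : stateDomain hnp Ω H ∈ 𝓝 w := (isOpen_stateDomain hΩ hH).mem_nhds hw
  have t0 : Tendsto (fun x : State N p × ℝ => x.1) (𝓝 w ×ˢ 𝓝[>] 0) (𝓝 w) := tendsto_fst
  have hR := ((continuousOn_eqnRate (hp := hp) hB hΩ hH hΩB hF hL1 hξ₀ hφ₀ hξ₁ hφ₁ hlam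
    α).continuousAt hU).tendsto.comp t0
  have hl : ContinuousAt (fun s : State N p => lam (nodeJet n (by omega) α s)) w :=
    ContinuousAt.comp (g := lam) (hlam.continuousOn.continuousAt (hΩ.mem_nhds (hw.1 α)))
      (nodeJet n (by omega) α).continuous.continuousAt
  have hlev : ∀ᶠ x : State N p × ℝ in 𝓝 w ×ˢ 𝓝[>] 0, |lam (nodeJet n (by omega) α x.1)|
      ≤ |lam (nodeJet n (by omega) α w)| + 1 :=
    ((hl.tendsto.comp t0).abs.eventually_lt_const (lt_add_one _)).mono fun x hx => hx.le
  have hq : ContinuousAt (fun s : State N p => fderiv ℝ (eqnB L1 α) s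
      (discreteX₁ hp ξ₀ ξ₁ φ₁ s)) w :=
    (((contDiffOn_eqnB hnp hL1 α).continuousOn_fderiv_of_isOpen (isOpen_stateDomain hΩ hH)
      (by simp)).clm_apply
      (contDiffOn_discreteX₁ hp hB hΩB hξ₀ hξ₁ hφ₁).continuousOn).continuousAt hU
  have hr : Tendsto (fun x : State N p × ℝ => (eqnRate hnp hp F lam L1 ξ₀ φ₀ ξ₁ φ₁ α x.1
      - eqnRate hnp hp F lam L1 ξ₀ φ₀ ξ₁ φ₁ α w)
      + x.2 * fderiv ℝ (eqnB L1 α) x.1 (discreteX₁ hp ξ₀ ξ₁ φ₁ x.1)) (𝓝 w ×ˢ 𝓝[>] 0) (𝓝 0) := by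
    simpa using (hR.sub_const (eqnRate hnp hp F lam L1 ξ₀ φ₀ ξ₁ φ₁ α w)).add
      ((tendsto_snd_zero w).mul (hq.tendsto.comp t0))
  filter_upwards [hlev, eventually_abs_mul_le (eventually_snd_pos w) hr hη,
    t0.eventually hU] with x h1 h2 hx
  have hx' : x.1 ∈ stateDomain hnp Ω H := hx
  rw [fderiv_eqnA hnp hΩ hF α hx', map_add, _root_.map_smul, nodeJet_discreteX₀ hp,
    nodeJet_discreteX₁ hp, map_add, _root_.map_smul]
  have h3 : fderiv ℝ F (nodeJet n (by omega) α x.1) (prolong ξ₀ φ₀ n (nodeJet n (by omega) α x.1))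
      = lam (nodeJet n (by omega) α x.1) * eqnA hnp F α x.1 := hsym _ (hx'.1 α)
  rw [h3]
  have h4 : fderiv ℝ F (nodeJet n (by omega) α x.1) (prolong ξ₁ φ₁ n (nodeJet n (by omega) α x.1))
      = applyOp ξ₁ φ₁ F (nodeJet n (by omega) α x.1) := rfl
  rw [h4]
  set R := eqnRate hnp hp F lam L1 ξ₀ φ₀ ξ₁ φ₁ α w
  rw [eqnRate] at h2
  -- Adding and subtracting `λ ε B` completes `λ A` to `λ (A + ε B)`; what remains is `ε` times the
  -- rate and a term in `ε²`.
  have h5 : ∀ l A b D D₀ D₁ ε : ℝ, l * A + ε • D + ε * (D₀ + ε • D₁) - ε * R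
      = l * (A + ε * b) + ε * (D + D₀ - l * b - R + ε * D₁) := by
    intros
    simp only [smul_eq_mul]
    ring
  rw [map_add, _root_.map_smul, h5 _ _ (eqnB L1 α x.1)]
  refine (abs_add_le _ _).trans (add_le_add ?_ h2)
  rw [abs_mul]
  gcongr

/-- On the states whose nodes coincide up to order `p`, the rate is expressed by the operator acting
on `L¹` with fixed steps. -/
theorem eqnRate_eq (hΩ : IsOpen Ω) (hH : IsOpen H)
    (hHcone : ∀ h ∈ H, ∀ t : ℝ, 0 < t → t • h ∈ H)
    (hL1 : ∀ α, ContDiffOn ℝ ∞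
      (fun w : Jet p × (Fin N → ℝ) => L1 α w.1 w.2) {w | w.1.trunc n hnp ∈ Ω ∧ w.2 ∈ H})
    {L : Fin (N + 1) → (Fin (N + 1) → ℝ) → (Fin (N + 1) → ℝ) → ℝ}
    (happrox : IsFirstDifferentialApproximation hnp Ω H F L L1) (α : Fin (N + 1)) {s : State N p}
    (hs : s ∈ stateDomain hnp Ω H) (hs0 : ∀ c, gridA c s = 0) :
    eqnRate hnp hp F lam L1 ξ₀ φ₀ ξ₁ φ₁ α s
      = applyOp ξ₁ φ₁ F (nodeJet n (by omega) α s)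
        + (applyOp ξ₀ φ₀ (fun w => L1 α w s.2) (nodeJet p (by omega) α s)
          + (totalD ξ₀ ((nodeJet p (by omega) α s).trunc (0 + 1) hp)
            - lam ((nodeJet p (by omega) α s).trunc n hnp))
            * L1 α (nodeJet p (by omega) α s) s.2) := by
  have hd : DifferentiableAt ℝ (fun w : Jet p × (Fin N → ℝ) => L1 α w.1 w.2)
      (nodeJet p (by omega) α s, s.2) :=
    ((hL1 α).contDiffAt ((isOpen_setOf_trunc_mem hΩ hH).mem_nhds
      ⟨hs.1 α, hs.2⟩)).differentiableAt (by simp)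
  have h1 : HasFDerivAt (eqnB L1 α) _ s := HasFDerivAt.comp
    (f := ((nodeJet p (by omega) α).prod (ContinuousLinearMap.snd ℝ _ _) :
      State N p →L[ℝ] Jet p × (Fin N → ℝ))) s hd.hasFDerivAt (ContinuousLinearMap.hasFDerivAt _)
  have h2 : fderiv ℝ (eqnB L1 α) s (discreteX₀ hp ξ₀ φ₀ s)
      = fderiv ℝ (fun w : Jet p × (Fin N → ℝ) => L1 α w.1 w.2) (nodeJet p (by omega) α s, s.2)
        (prolong ξ₀ φ₀ p (nodeJet p (by omega) α s),
          totalD ξ₀ ((nodeJet p (by omega) α s).trunc (0 + 1) hp) • s.2) := by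
    rw [h1.fderiv, ContinuousLinearMap.comp_apply]
    congr 1
    refine Prod.ext rfl (funext fun i => ?_)
    -- `D ξ₀` uses only 1-jets and `1 ≤ p`, so its value is the same at all nodes and the steps are
    -- scaled uniformly.
    have h3 : nodeJet (0 + 1) (by omega) i.castSucc s = nodeJet (0 + 1) (by omega) α s :=
      nodeJet_eq_of_gridA_eq_zero hs0 hp _ _
    change s.2 i * totalD ξ₀ (nodeJet (0 + 1) (by omega) i.castSucc s)
      = totalD ξ₀ (nodeJet (0 + 1) (by omega) α s) * s.2 i
    rw [h3, mul_comm]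
  rw [eqnRate, h2, fderiv_apply_smul_steps hΩ hH hHcone hL1 happrox α (hs.1 α) hs.2]
  simp only [applyOp, eqnB]
  change _ + _ - lam ((nodeJet p (by omega) α s).trunc n hnp) * _ = _
  ring

end Equation

/-! ### Persistence of the order-zero equations along the flow -/

section Flow

variable {N n p : ℕ} {hnp : n ≤ p} {hp : 1 ≤ p} {B : Set (Jet 0)} {Ω : Set (Jet n)}
  {H : Set (Fin N → ℝ)} {F lam : Jet n → ℝ} {ξ₀ φ₀ : Jet 0 → ℝ} {X₁ : State N p → State N p}
  {V : Set (State N p)} {T : ℝ} {f₀ f₁ : State N p → ℝ → State N p} {z₀ : State N p}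

/-- The `p`-jets of all nodes are integral curves of the same prolonged field; if they agree
initially, uniqueness keeps them equal. -/
theorem gridA_flow_eq_zero (hB : IsOpen B) (hΩB : ∀ z ∈ Ω, z.trunc 0 (Nat.zero_le n) ∈ B)
    (hξ₀ : ContDiffOn ℝ ∞ ξ₀ B) (hφ₀ : ContDiffOn ℝ ∞ φ₀ B)
    (hg : IsApproxGroup (stateDomain hnp Ω H) (discreteX₀ hp ξ₀ φ₀) X₁ V T f₀ f₁)
    (hz₀ : z₀ ∈ V) (h0 : ∀ c, gridA c z₀ = 0) {t : ℝ} (ht : t ∈ Ioo (-T) T)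
    (c : Fin N × Option (Fin (p + 1))) : gridA c (f₀ z₀ t) = 0 := by
  have hcurve : ∀ α : Fin (N + 1), ∀ t ∈ Ioo (-T) T,
      HasDerivAt (fun t => nodeJet p (by omega) α (f₀ z₀ t))
        (prolong ξ₀ φ₀ p (nodeJet p (by omega) α (f₀ z₀ t))) t ∧
      nodeJet p (by omega) α (f₀ z₀ t) ∈ jetsOver B p := fun α t ht =>
    ⟨(nodeJet p (by omega) α).hasFDerivAt.comp_hasDerivAt t (hg.deriv₀ _ hz₀ t ht),
      nodeJet_mem_jetsOver hΩB (hg.mem _ hz₀ t ht) _ α⟩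
  refine gridA_eq_zero_iff.2 (fun i => ?_) c
  refine eqOn_of_hasDerivAt_of_contDiffOn (isOpen_jetsOver hB)
    ((contDiffOn_prolong hB hξ₀ hφ₀ p).of_le (by simp)) (hcurve i.succ) (hcurve i.castSucc) ?_ ht
  rw [hg.init₀ _ hz₀]
  exact gridA_eq_zero_iff.1 h0 i

theorem uIcc_zero_subset_Ioo {a T : ℝ} (ha : a ∈ Ioo (-T) T) : uIcc 0 a ⊆ Ioo (-T) T := by
  have hT : 0 < T := by linarith [ha.1, ha.2]
  exact (convex_Ioo (-T) T).ordConnected.uIcc_subset ⟨by linarith, hT⟩ ha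

theorem continuousOn_flow
    (hg : IsApproxGroup (stateDomain hnp Ω H) (discreteX₀ hp ξ₀ φ₀) X₁ V T f₀ f₁)
    (hz₀ : z₀ ∈ V) {a : ℝ} (ha : a ∈ Ioo (-T) T) : ContinuousOn (f₀ z₀) (uIcc 0 a) :=
  fun t ht => (hg.deriv₀ _ hz₀ t (uIcc_zero_subset_Ioo ha ht)).continuousAt.continuousWithinAt

theorem exists_forall_abs_lam_le (hlam : ContDiffOn ℝ ∞ lam Ω)
    (hg : IsApproxGroup (stateDomain hnp Ω H) (discreteX₀ hp ξ₀ φ₀) X₁ V T f₀ f₁)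
    (hz₀ : z₀ ∈ V) {a : ℝ} (ha : a ∈ Ioo (-T) T) (α : Fin (N + 1)) :
    ∃ K, 0 ≤ K ∧ ∀ t ∈ uIcc 0 a, |lam (nodeJet n (by omega) α (f₀ z₀ t))| ≤ K := by
  have hc : ContinuousOn (fun t => lam (nodeJet n (by omega) α (f₀ z₀ t))) (uIcc 0 a) :=
    hlam.continuousOn.comp ((nodeJet n (by omega) α).continuous.comp_continuousOn
      (continuousOn_flow hg hz₀ ha)) fun t ht => (hg.mem _ hz₀ t (uIcc_zero_subset_Ioo ha ht)).1 α
  obtain ⟨K, hK⟩ := isCompact_uIcc.exists_bound_of_continuousOn hc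
  exact ⟨K, (norm_nonneg _).trans (hK 0 left_mem_uIcc), hK⟩

/-- Along the flow `F` satisfies the linear equation `F' = λ F`, so a zero initial value stays zero.
-/
theorem eqnA_flow_eq_zero (hΩ : IsOpen Ω) (hF : ContDiffOn ℝ ∞ F Ω)
    (hlam : ContDiffOn ℝ ∞ lam Ω) (hsym : ∀ z ∈ Ω, applyOp ξ₀ φ₀ F z = lam z * F z)
    (hg : IsApproxGroup (stateDomain hnp Ω H) (discreteX₀ hp ξ₀ φ₀) X₁ V T f₀ f₁)
    (hz₀ : z₀ ∈ V) {α : Fin (N + 1)} (h0 : eqnA hnp F α z₀ = 0) {a : ℝ} (ha : a ∈ Ioo (-T) T) :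
    eqnA hnp F α (f₀ z₀ a) = 0 := by
  obtain ⟨K, hK0, hK⟩ := exists_forall_abs_lam_le hlam hg hz₀ ha α
  have hd : ∀ t ∈ uIcc 0 a, HasDerivAt (fun t => eqnA hnp F α (f₀ z₀ t))
      (lam (nodeJet n (by omega) α (f₀ z₀ t)) * eqnA hnp F α (f₀ z₀ t)) t := by
    intro t ht
    have htT := uIcc_zero_subset_Ioo ha ht
    have hm := (hg.mem _ hz₀ t htT).1 α
    have h1 : HasFDerivAt F _ (nodeJet n (by omega) α (f₀ z₀ t)) :=
      ((hF.contDiffAt (hΩ.mem_nhds hm)).differentiableAt (by simp)).hasFDerivAt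
    have h2 := h1.comp_hasDerivAt t
      ((nodeJet n (by omega) α).hasFDerivAt.comp_hasDerivAt t (hg.deriv₀ _ hz₀ t htT))
    rw [nodeJet_discreteX₀ hp] at h2
    have h3 := hsym _ hm
    rw [applyOp] at h3
    exact h2.congr_deriv h3
  have := norm_le_of_norm_deriv_le_uIcc hK0 le_rfl hd (δ := 0)
    (by simp [hg.init₀ _ hz₀, h0]) (by
      intro t ht
      rw [norm_mul, add_zero]
      exact mul_le_mul_of_nonneg_right (hK t ht) (norm_nonneg _))
  simpa using this

end Flow

/-! ### Approximate solutions and vanishing of the rate -/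

section ApproximateSolutions

variable {E : Type*} [NormedAddCommGroup E] [NormedSpace ℝ E]

theorem tendsto_of_isLittleO_sub {z : ℝ → E} {z₀ z₁ : E}
    (h : (fun ε : ℝ => z ε - z₀ - ε • z₁) =o[𝓝[>] 0] fun ε : ℝ => ε) :
    Tendsto z (𝓝[>] 0) (𝓝 z₀) := by
  have hid : Tendsto (fun ε : ℝ => ε) (𝓝[>] 0) (𝓝 0) := tendsto_id.mono_right nhdsWithin_le_nhds
  have h1 := h.isBigO.trans_tendsto hid
  have h2 := (h1.add (hid.smul_const z₁)).add_const z₀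
  simpa using h2

theorem eq_zero_of_isLittleO_add_mul {M : Type*} [TopologicalSpace M] {A B : M → ℝ}
    {z : ℝ → M} {z₀ : M}
    (hz : Tendsto z (𝓝[>] 0) (𝓝 z₀)) (hA : ContinuousAt A z₀) (hB : ContinuousAt B z₀)
    (h : (fun ε : ℝ => A (z ε) + ε * B (z ε)) =o[𝓝[>] 0] fun ε : ℝ => ε) : A z₀ = 0 := by
  have hid : Tendsto (fun ε : ℝ => ε) (𝓝[>] 0) (𝓝 0) := tendsto_id.mono_right nhdsWithin_le_nhds
  have h1 := h.isBigO.trans_tendsto hid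
  have h2 := (hA.tendsto.comp hz).add (hid.mul (hB.tendsto.comp hz))
  simpa using tendsto_nhds_unique h2 h1

/-- First-order Taylor expansion; it reduces the construction of approximate solutions to linear
equations for `z₁`. -/
theorem isLittleO_add_smul {A B : E → ℝ} {z₀ z₁ : E} (hA : DifferentiableAt ℝ A z₀)
    (hB : ContinuousAt B z₀) (h0 : A z₀ = 0) (h1 : fderiv ℝ A z₀ z₁ + B z₀ = 0) :
    (fun ε : ℝ => A (z₀ + ε • z₁) + ε * B (z₀ + ε • z₁)) =o[𝓝[>] 0] fun ε : ℝ => ε := by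
  have hl : HasDerivAt (fun ε : ℝ => z₀ + ε • z₁) z₁ 0 := by
    simpa using ((hasDerivAt_id (0 : ℝ)).smul_const z₁).const_add z₀
  have hd : HasDerivAt (fun ε : ℝ => A (z₀ + ε • z₁)) (fderiv ℝ A z₀ z₁) 0 :=
    HasFDerivAt.comp_hasDerivAt (l := A) (f := fun ε : ℝ => z₀ + ε • z₁) (0 : ℝ)
      (by simpa using hA.hasFDerivAt) hl
  have e1 := hd.isLittleO
  have hBt : Tendsto (fun ε : ℝ => B (z₀ + ε • z₁) - B z₀) (𝓝 0) (𝓝 0) := by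
    have h2 : Tendsto (fun ε : ℝ => z₀ + ε • z₁) (𝓝 0) (𝓝 z₀) := by
      simpa using hl.continuousAt.tendsto
    simpa using (hB.tendsto.comp h2).sub_const (B z₀)
  have e2 : (fun ε : ℝ => ε * (B (z₀ + ε • z₁) - B z₀)) =o[𝓝 0] fun ε : ℝ => ε * 1 :=
    (isBigO_refl _ _).mul_isLittleO ((isLittleO_one_iff ℝ).2 hBt)
  simp only [sub_zero, zero_smul, add_zero, h0, smul_eq_mul] at e1
  simp only [mul_one] at e2
  refine ((e1.add e2).congr_left fun ε => ?_).mono nhdsWithin_le_nhds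
  linear_combination -ε * h1

theorem isLittleO_unit_iff {f : ℝ → ℝ} :
    ((fun (ε : ℝ) (_ : Unit) => f ε) =o[𝓝[>] 0] fun ε : ℝ => ε) ↔
      f =o[𝓝[>] 0] fun ε : ℝ => ε := by
  simp [isLittleO_pi]

/-- Transfers an estimate at `z₀` to the trajectory points `f₀ z₀ t` with `t` small. -/
theorem eventually_nhds_eventually_prod {α β : Type*} [TopologicalSpace α] {l : Filter β}
    {w : α} {P : α × β → Prop} (h : ∀ᶠ x in 𝓝 w ×ˢ l, P x) :
    ∀ᶠ w' in 𝓝 w, ∀ᶠ x in 𝓝 w' ×ˢ l, P x := by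
  rw [eventually_prod_iff] at h
  obtain ⟨pa, ha, pb, hb, hab⟩ := h
  filter_upwards [eventually_eventually_nhds.2 ha] with w' hw'
  exact eventually_prod_iff.2 ⟨pa, hw', pb, hb, hab⟩

/-- If `A + ε B = o(ε)` is preserved by the approximate group, then the rate of change of first
order in `ε` vanishes. -/
theorem IsApproxGroup.rate_eq_zero {U V : Set E} {X₀ X₁ : E → E} {T : ℝ} {f₀ f₁ : E → ℝ → E}
    (hU : IsOpen U) (hX₀ : ContDiffOn ℝ 1 X₀ U) (hX₁ : ContinuousOn X₁ U)
    (hg : IsApproxGroup U X₀ X₁ V T f₀ f₁) {z : ℝ → E} {z₀ : E} (hz₀ : z₀ ∈ V)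
    (hz : Tendsto z (𝓝[>] 0) (𝓝 z₀)) {A B : E → ℝ} (hA : ContDiffOn ℝ 1 A U)
    (hB : ContDiffOn ℝ 1 B U) {K c : ℝ} (hK : 0 ≤ K)
    (hinf : ∀ η > 0, ∀ᶠ x : E × ℝ in 𝓝 z₀ ×ˢ 𝓝[>] 0,
      |fderiv ℝ A x.1 (X₀ x.1 + x.2 • X₁ x.1)
          + x.2 * fderiv ℝ B x.1 (X₀ x.1 + x.2 • X₁ x.1) - x.2 * c|
        ≤ K * |A x.1 + x.2 * B x.1| + η * x.2)
    (h0 : (fun ε => A (z ε) + ε * B (z ε)) =o[𝓝[>] 0] fun ε : ℝ => ε)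
    (hinv : ∀ a ∈ Ioo (-T) T, (fun ε => A (f₀ (z ε) a + ε • f₁ (z ε) a)
      + ε * B (f₀ (z ε) a + ε • f₁ (z ε) a)) =o[𝓝[>] 0] fun ε : ℝ => ε) : c = 0 := by
  by_contra hc
  have hc0 : 0 < |c| := abs_pos.2 hc
  have hT : 0 < T := hg.pos
  have hcont : Tendsto (f₀ z₀) (𝓝 0) (𝓝 z₀) := by
    have := (hg.deriv₀ z₀ hz₀ 0 ⟨by linarith, hT⟩).continuousAt.tendsto
    rwa [hg.init₀ z₀ hz₀] at this
  obtain ⟨τ, hτ, hτP⟩ := Metric.eventually_nhds_iff.1 (hcont.eventually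
    (eventually_nhds_eventually_prod (hinf (|c| / 16) (by positivity))))
  -- The time is so short that the drift `ε a c` dominates the Grönwall error; `K a ≤ 1/8` also
  -- gives `exp (K a) ≤ 3`.
  obtain ⟨a, ha0, haτ, haT, haK⟩ : ∃ a : ℝ, 0 < a ∧ a < τ ∧ a < T ∧ K * a ≤ 1 / 8 := by
    refine ⟨min (min τ T / 2) (1 / 8 / (K + 1)), by positivity, ?_, ?_, ?_⟩
    · have : min τ T / 2 < τ := by linarith [min_le_left τ T, hτ]
      exact (min_le_left _ _).trans_lt this
    · have : min τ T / 2 < T := by linarith [min_le_right τ T, hT]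
      exact (min_le_left _ _).trans_lt this
    · calc K * min (min τ T / 2) (1 / 8 / (K + 1)) ≤ (K + 1) * (1 / 8 / (K + 1)) := by
            gcongr
            · linarith
            · exact min_le_right _ _
        _ = 1 / 8 := by field_simp
  have haI : a ∈ Ioo (-T) T := ⟨by linarith, haT⟩
  have key := hg.norm_transform_sub_le (ι := Unit) hU hX₀ hX₁ hz₀ hz (A := fun _ => A)
    (B := fun _ => B) (fun _ => hA) (fun _ => hB) haI hK (δ := a * (|c| / 16))
    (η := |c| / 16) (by positivity) (by positivity) (fun _ => c) (by
      intro t ht _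
      rw [uIcc_of_le ha0.le] at ht
      have hdist : dist t 0 < τ := by
        rw [Real.dist_eq, sub_zero, abs_of_nonneg ht.1]
        exact ht.2.trans_lt haτ
      simpa only [pi_norm_const, Real.norm_eq_abs] using hτP hdist)
    (isLittleO_unit_iff.2 h0)
  obtain ⟨ε, h1, h2, hε⟩ := (key.and (((hinv a haI).def (c := a * |c| / 32) (by positivity)).and
    self_mem_nhdsWithin)).exists
  have hε : 0 < ε := hε
  simp only [pi_norm_const, Real.norm_eq_abs, abs_of_pos ha0, abs_of_pos hε] at h1 h2
  have hexp : Real.exp (K * a) ≤ 3 := by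
    have h3 : Real.exp (K * a) ≤ Real.exp 1 := Real.exp_le_exp.2 (by linarith)
    linarith [Real.exp_one_lt_d9]
  -- The error is at most `3 · 5/16 = 15/16` of `ε a |c|`, and invariance bounds the value itself by
  -- a further `1/32`. These add up to less than `1`, a contradiction.
  set M := a * (|c| / 16) + a * (K * (a * |c|) + 2 * (|c| / 16)) with hM
  have hM0 : 0 ≤ M := by positivity
  have hM1 : M ≤ a * |c| * (5 / 16) := by
    have : a * |c| * (K * a) ≤ a * |c| * (1 / 8) := by gcongr
    rw [hM]
    linarith
  have h4 : M * Real.exp (K * a) ≤ a * |c| * (5 / 16) * 3 := by gcongr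
  have h5 : ε * (M * Real.exp (K * a)) ≤ ε * (a * |c| * (5 / 16) * 3) := by gcongr
  have h6 : |ε * (a * c)| = ε * (a * |c|) := by
    rw [abs_mul, abs_mul, abs_of_pos hε, abs_of_pos ha0]
  have h7 := abs_sub_abs_le_abs_sub (ε * (a * c)) (A (f₀ (z ε) a + ε • f₁ (z ε) a)
    + ε * B (f₀ (z ε) a + ε • f₁ (z ε) a))
  rw [abs_sub_comm, h6] at h7
  have h8 : 0 < ε * (a * |c|) := by positivity
  linarith

end ApproximateSolutions

/-! ### Approximate solutions over a prescribed jet -/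

section InitialStates

variable {N n p : ℕ}

/-- The jet of higher order with vanishing higher derivatives. -/
def jetExtend (k : ℕ) {m : ℕ} (z : Jet m) : Jet k :=
  (z.1, fun j => if hj : (j : ℕ) < m + 1 then z.2 ⟨j, hj⟩ else 0)

theorem trunc_jetExtend {k m : ℕ} (hk : m ≤ k) (z : Jet m) : (jetExtend k z).trunc m hk = z := by
  refine Prod.ext rfl (funext fun j => ?_)
  exact dif_pos j.2

/-- The first-order displacement along the trajectory with the given derivatives. -/
def jetTangent {k : ℕ} (z : Jet k) : Jet k :=
  (1, fun j => if hj : (j : ℕ) + 1 < k + 1 then z.2 ⟨j + 1, hj⟩ else 0)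

theorem stepSum_self (h : Fin N → ℝ) (α : Fin (N + 1)) : stepSum h α α = 0 := sub_self _

theorem stepSum_succ_sub (h : Fin N → ℝ) (i : Fin N) (α : Fin (N + 1)) :
    stepSum h i.succ α - stepSum h i.castSucc α = h i := by
  simp only [stepSum, sub_sub_sub_cancel_right]
  rw [← Finset.sum_sub_distrib, Finset.sum_eq_single i]
  · simp
  · intro j _ hj
    have h1 : (j.castSucc < i.succ) ↔ (j.castSucc < i.castSucc) := by
      rw [Fin.castSucc_lt_succ_iff, Fin.castSucc_lt_castSucc_iff]
      exact ⟨fun h => lt_of_le_of_ne h hj, le_of_lt⟩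
    simp only [h1, sub_self]
  · simp

/-- The state all of whose nodes carry the same jet. -/
def constState (z : Jet p) (h : Fin N → ℝ) : State N p := (fun _ => jetExtend (2 * p) z, h)

/-- A first-order displacement that satisfies the grid relations and is prescribed at one node. -/
def gridDisplacement (z : Jet p) (h : Fin N → ℝ) (α : Fin (N + 1)) (v : Jet n) : State N p :=
  (fun β => jetExtend (2 * p) v + stepSum h β α • jetTangent (jetExtend (2 * p) z), 0)

theorem gridA_constState (z : Jet p) (h : Fin N → ℝ) (c : Fin N × Option (Fin (p + 1))) :
    gridA c (constState z h) = 0 :=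
  gridA_eq_zero_iff.2 (fun _ => rfl) c

/-- The part `v` is common to all nodes and drops out of the differences, while `h_{β,α}` times the
tangent changes by `h_i` times the tangent across step `i`. -/
theorem gridA_gridDisplacement (hp : 1 ≤ p) (z : Jet p) (h : Fin N → ℝ) (α : Fin (N + 1))
    (v : Jet n) (c : Fin N × Option (Fin (p + 1))) :
    gridA c (gridDisplacement z h α v) + gridB hp c (constState z h) = 0 := by
  rcases c with ⟨i, _ | J⟩
  · have h1 : gridA (i, none) (gridDisplacement z h α v)
        = (stepSum h i.succ α - stepSum h i.castSucc α) * 1 := by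
      change (_ + _ * (1 : ℝ)) - (_ + _ * (1 : ℝ)) = _
      ring
    rw [h1, stepSum_succ_sub]
    change h i * 1 + -h i = 0
    ring
  · have hJ : (J : ℕ) + 1 < 2 * p + 1 := by omega
    have hJ' : (jetTangent (jetExtend (2 * p) z)).2 (Fin.castLE (by omega) J)
        = (jetExtend (2 * p) z).2 ⟨J + 1, hJ⟩ := dif_pos hJ
    have h1 : gridA (i, some J) (gridDisplacement z h α v)
        = (stepSum h i.succ α - stepSum h i.castSucc α)
          * (jetTangent (jetExtend (2 * p) z)).2 (Fin.castLE (by omega) J) := by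
      have key : ∀ a b c d : ℝ, (a + b * d) - (a + c * d) = (b - c) * d := by
        intros
        ring
      exact key _ _ _ _
    rw [h1, stepSum_succ_sub, hJ']
    exact add_neg_cancel (h i * (jetExtend (2 * p) z).2 ⟨J + 1, hJ⟩)

theorem nodeJet_gridDisplacement (hn : n ≤ 2 * p) (z : Jet p) (h : Fin N → ℝ)
    (α : Fin (N + 1)) (v : Jet n) : nodeJet n hn α (gridDisplacement z h α v) = v := by
  rw [nodeJet_apply]
  simp only [gridDisplacement, stepSum_self, zero_smul, add_zero, trunc_jetExtend]

end InitialStates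

/-! ### Invariance of the system versus vanishing of the rate -/

section Main

variable {N n p : ℕ} {hnp : n ≤ p} {hp : 1 ≤ p} {B : Set (Jet 0)} {Ω : Set (Jet n)}
  {H : Set (Fin N → ℝ)} {F lam : Jet n → ℝ} {L1 : Fin (N + 1) → Jet p → (Fin N → ℝ) → ℝ}
  {ξ₀ φ₀ ξ₁ φ₁ : Jet 0 → ℝ}

/-- The approximate group of `X₀^Δ` with `X₁ = 0` preserves the discrete system if the rate of the
equation vanishes on its zero-order solutions. -/
theorem approxInvariant_of_eqnRate_eq_zero (hB : IsOpen B) (hΩ : IsOpen Ω) (hH : IsOpen H)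
    (hΩB : ∀ z ∈ Ω, z.trunc 0 (Nat.zero_le n) ∈ B) (hF : ContDiffOn ℝ ∞ F Ω)
    (hL1 : ∀ α, ContDiffOn ℝ ∞
      (fun w : Jet p × (Fin N → ℝ) => L1 α w.1 w.2) {w | w.1.trunc n hnp ∈ Ω ∧ w.2 ∈ H})
    (hξ₀ : ContDiffOn ℝ ∞ ξ₀ B) (hφ₀ : ContDiffOn ℝ ∞ φ₀ B) (hlam : ContDiffOn ℝ ∞ lam Ω)
    (hsym : ∀ z ∈ Ω, applyOp ξ₀ φ₀ F z = lam z * F z) (α : Fin (N + 1))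
    (hrate : ∀ s ∈ stateDomain hnp Ω H, (∀ c, gridA c s = 0) → eqnA hnp F α s = 0 →
      eqnRate hnp hp F lam L1 ξ₀ φ₀ (fun _ => 0) (fun _ => 0) α s = 0) :
    ApproxInvariant (stateDomain hnp Ω H) (discreteX₀ hp ξ₀ φ₀)
      (discreteX₁ hp ξ₀ (fun _ => 0) (fun _ => 0)) (discreteSystem hnp hp F L1 α) := by
  intro V T f₀ f₁ hg z z₀ z₁ hz₀ hsol a ha
  have hU : IsOpen (stateDomain hnp Ω H) := isOpen_stateDomain hΩ hH
  have hX₀ : ContDiffOn ℝ 1 (discreteX₀ hp ξ₀ φ₀ : State N p → _) (stateDomain hnp Ω H) :=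
    (contDiffOn_discreteX₀ hp hB hΩB hξ₀ hφ₀).of_le (by simp)
  have hX₁ : ContinuousOn (discreteX₁ hp ξ₀ (fun _ => 0) (fun _ => 0) : State N p → _)
      (stateDomain hnp Ω H) :=
    (contDiffOn_discreteX₁ hp hB hΩB hξ₀ contDiffOn_const contDiffOn_const).continuousOn
  have hA := contDiffOn_eqnA (N := N) (H := H) hnp hF α
  have hBs := contDiffOn_eqnB hnp hL1 α
  have hzt : Tendsto z (𝓝[>] 0) (𝓝 z₀) := tendsto_of_isLittleO_sub hsol.1
  have hz₀U : stateDomain hnp Ω H ∈ 𝓝 z₀ := hU.mem_nhds (hg.subset hz₀)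
  obtain ⟨heqn, hgrid⟩ := (isLittleO_discreteSystem_iff hp).1 hsol.2
  have hA0 : eqnA hnp F α z₀ = 0 :=
    eq_zero_of_isLittleO_add_mul hzt (hA.continuousOn.continuousAt hz₀U)
      (hBs.continuousOn.continuousAt hz₀U) heqn
  have hgrid0 : ∀ c, gridA c z₀ = 0 := fun c =>
    eq_zero_of_isLittleO_add_mul hzt (gridA c).continuous.continuousAt
      (contDiff_gridB hp c).continuous.continuousAt (isLittleO_pi.1 hgrid c)
  have hgridt : ∀ t ∈ uIcc 0 a, ∀ c, gridA c (f₀ z₀ t) = 0 := fun t ht c =>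
    gridA_flow_eq_zero hB hΩB hξ₀ hφ₀ hg hz₀ hgrid0 (uIcc_zero_subset_Ioo ha ht) c
  have hmem : ∀ t ∈ uIcc 0 a, f₀ z₀ t ∈ stateDomain hnp Ω H := fun t ht =>
    hg.mem _ hz₀ t (uIcc_zero_subset_Ioo ha ht)
  refine (isLittleO_discreteSystem_iff hp).2 ⟨?_, ?_⟩
  · obtain ⟨K, hK0, hK⟩ := exists_forall_abs_lam_le hlam hg hz₀ ha α
    refine isLittleO_unit_iff.1 (hg.isLittleO_transform (ι := Unit) hU hX₀ hX₁ hz₀ hzt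
      (A := fun _ => eqnA hnp F α) (B := fun _ => eqnB L1 α) (fun _ => hA.of_le (by simp))
      (fun _ => hBs.of_le (by simp)) ha (K := K + 1) (by linarith) ?_ (isLittleO_unit_iff.2 heqn))
    intro t ht _ η hη
    have h0 := hrate _ (hmem t ht) (hgridt t ht)
      (eqnA_flow_eq_zero hΩ hF hlam hsym hg hz₀ hA0 (uIcc_zero_subset_Ioo ha ht))
    filter_upwards [eventually_abs_deriv_eqn_le (hp := hp) hB hΩ hH hΩB hF hL1 hξ₀ hφ₀
      contDiffOn_const contDiffOn_const hlam hsym α (hmem t ht) hη] with x hx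
    rw [h0, mul_zero, sub_zero] at hx
    simp only [pi_norm_const, Real.norm_eq_abs]
    refine hx.trans ?_
    gcongr
    exact hK t ht
  · have hbd : ∀ c : Fin N × Option (Fin (p + 1)), ∃ K, ∀ t ∈ uIcc 0 a,
        ‖gridGradNorm ξ₀ φ₀ c (f₀ z₀ t)‖ ≤ K := fun c =>
      isCompact_uIcc.exists_bound_of_continuousOn
        ((continuousOn_gridGradNorm hB hΩB hξ₀ hφ₀ c).comp (continuousOn_flow hg hz₀ ha) hmem)
    choose K hK using hbd
    have hK0 : ∀ c, 0 ≤ K c := fun c => (norm_nonneg _).trans (hK c 0 left_mem_uIcc)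
    -- The vector Grönwall estimate needs a single constant; the sum of the `K c` dominates them
    -- all.
    refine hg.isLittleO_transform hU hX₀ hX₁ hz₀ hzt (A := fun c => gridA c)
      (B := fun c => gridB hp c) (fun c => (gridA c).contDiff.contDiffOn)
      (fun c => ((contDiff_gridB hp c).of_le (by simp)).contDiffOn) ha (K := ∑ c, K c + 1)
      (by have := Finset.sum_nonneg fun c (_ : c ∈ Finset.univ) => hK0 c; linarith) ?_ hgrid
    intro t ht c η hη
    filter_upwards [eventually_abs_deriv_grid_le hp hB hΩ hH hΩB hξ₀ hφ₀ (hmem t ht)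
      (hgridt t ht) c hη] with x hx
    refine hx.trans ?_
    have h1 : gridGradNorm ξ₀ φ₀ c (f₀ z₀ t) ≤ ∑ c, K c :=
      ((le_abs_self _).trans (hK c t ht)).trans
        (Finset.single_le_sum (fun c _ => hK0 c) (Finset.mem_univ c))
    change _ ≤ (∑ c, K c + 1) * ‖gridLHS hp x.1 x.2‖ + η * x.2
    gcongr

/-- If the approximate group preserves the discrete system, then the rate of the equation vanishes
at every state whose nodes carry the same solution of the differential equation. -/
theorem eqnRate_eq_zero_of_approxInvariant (hB : IsOpen B) (hΩ : IsOpen Ω) (hH : IsOpen H)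
    (hΩB : ∀ z ∈ Ω, z.trunc 0 (Nat.zero_le n) ∈ B) (hF : ContDiffOn ℝ ∞ F Ω)
    (hrank : ∀ z ∈ Ω, F z = 0 → fderiv ℝ F z ≠ 0)
    (hL1 : ∀ α, ContDiffOn ℝ ∞
      (fun w : Jet p × (Fin N → ℝ) => L1 α w.1 w.2) {w | w.1.trunc n hnp ∈ Ω ∧ w.2 ∈ H})
    (hξ₀ : ContDiffOn ℝ ∞ ξ₀ B) (hφ₀ : ContDiffOn ℝ ∞ φ₀ B) (hξ₁ : ContDiffOn ℝ ∞ ξ₁ B)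
    (hφ₁ : ContDiffOn ℝ ∞ φ₁ B) (hlam : ContDiffOn ℝ ∞ lam Ω)
    (hsym : ∀ z ∈ Ω, applyOp ξ₀ φ₀ F z = lam z * F z) (α : Fin (N + 1))
    (hinv : ApproxInvariant (stateDomain hnp Ω H) (discreteX₀ hp ξ₀ φ₀)
      (discreteX₁ hp ξ₀ ξ₁ φ₁) (discreteSystem hnp hp F L1 α))
    {z : Jet p} {h : Fin N → ℝ} (hz : z.trunc n hnp ∈ Ω)
    (hFz : F (z.trunc n hnp) = 0) (hs : constState z h ∈ stateDomain hnp Ω H)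
    (hnode : nodeJet n (by omega) α (constState z h) = z.trunc n hnp) :
    eqnRate hnp hp F lam L1 ξ₀ φ₀ ξ₁ φ₁ α (constState z h) = 0 := by
  set s₀ : State N p := constState z h with hs₀
  have hU : IsOpen (stateDomain hnp Ω H) := isOpen_stateDomain hΩ hH
  have hX₀ : ContDiffOn ℝ ∞ (discreteX₀ hp ξ₀ φ₀ : State N p → _) (stateDomain hnp Ω H) :=
    contDiffOn_discreteX₀ hp hB hΩB hξ₀ hφ₀
  have hX₁ : ContDiffOn ℝ ∞ (discreteX₁ hp ξ₀ ξ₁ φ₁ : State N p → _) (stateDomain hnp Ω H) :=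
    contDiffOn_discreteX₁ hp hB hΩB hξ₀ hξ₁ hφ₁
  have hA := contDiffOn_eqnA (N := N) (H := H) hnp hF α
  have hBs := contDiffOn_eqnB hnp hL1 α
  have hsU : stateDomain hnp Ω H ∈ 𝓝 s₀ := hU.mem_nhds hs
  -- A nonzero linear functional is onto: this is where the maximal rank of `F` enters, to cancel
  -- `L¹` at first order.
  obtain ⟨v, hv⟩ : ∃ v, fderiv ℝ F (z.trunc n hnp) v = -eqnB L1 α s₀ := by
    obtain ⟨u, hu⟩ := DFunLike.ne_iff.1 (hrank _ hz hFz)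
    rw [zero_apply] at hu
    refine ⟨(-eqnB L1 α s₀ / fderiv ℝ F (z.trunc n hnp) u) • u, ?_⟩
    rw [_root_.map_smul, smul_eq_mul, div_mul_cancel₀ _ hu]
  set s₁ : State N p := gridDisplacement z h α v with hs₁
  have heqn : (fun ε : ℝ => eqnA hnp F α (s₀ + ε • s₁) + ε * eqnB L1 α (s₀ + ε • s₁))
      =o[𝓝[>] 0] fun ε : ℝ => ε := by
    refine isLittleO_add_smul ((hA.contDiffAt hsU).differentiableAt (by simp))
      (hBs.continuousOn.continuousAt hsU) ?_ ?_
    · rw [eqnA, hnode, hFz]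
    · rw [fderiv_eqnA hnp hΩ hF α hs, hnode, nodeJet_gridDisplacement, hv, neg_add_cancel]
  have hgrid : (fun (ε : ℝ) c => gridA c (s₀ + ε • s₁) + ε * gridB hp c (s₀ + ε • s₁))
      =o[𝓝[>] 0] fun ε : ℝ => ε := by
    refine isLittleO_pi.2 fun c => isLittleO_add_smul (gridA c).differentiableAt
      (contDiff_gridB hp c).continuous.continuousAt (gridA_constState z h c) ?_
    rw [ContinuousLinearMap.fderiv]
    exact gridA_gridDisplacement hp z h α v c
  have hlin : (fun ε : ℝ => s₀ + ε • s₁ - s₀ - ε • s₁) =o[𝓝[>] 0] fun ε : ℝ => ε := by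
    simp only [add_sub_cancel_left, sub_self]
    exact isLittleO_zero _ _
  -- `ApproxInvariant` quantifies over all groups, so it says something at `s₀` only once a group is
  -- known to exist there.
  obtain ⟨V, T, f₀, f₁, hsV, hg⟩ := exists_isApproxGroup hU
    (hX₀.of_le
      (show ((2 : ℕ∞) : WithTop ℕ∞) ≤ ((⊤ : ℕ∞) : WithTop ℕ∞) from WithTop.coe_le_coe.2 le_top))
    (hX₁.of_le (by simp)) hs
  have hpres := hinv V T f₀ f₁ hg (fun ε => s₀ + ε • s₁) s₀ s₁ hsV
    ⟨hlin, (isLittleO_discreteSystem_iff hp).2 ⟨heqn, hgrid⟩⟩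
  refine hg.rate_eq_zero hU (hX₀.of_le (by simp)) hX₁.continuousOn hsV
    (tendsto_of_isLittleO_sub hlin) (hA.of_le (by simp)) (hBs.of_le (by simp))
    (K := |lam (nodeJet n (by omega) α s₀)| + 1) (by positivity) (fun η hη => ?_) heqn
    (fun a ha => ((isLittleO_discreteSystem_iff hp).1 (hpres a ha)).1)
  exact eventually_abs_deriv_eqn_le (hp := hp) hB hΩ hH hΩB hF hL1 hξ₀ hφ₀ hξ₁ hφ₁ hlam hsym α hs hη

end Main

end FDStability

end

/-! ### The stability criterion -/

theorem theorem5 {N n p : ℕ} (hnp : n ≤ p) (hp : 1 ≤ p)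
    -- the domains of `(x, y)`, of `(x, y, …, y⁽ⁿ⁾)` and of the step sizes
    (B : Set (FDStability.Jet 0)) (hB : IsOpen B)
    (Ω : Set (FDStability.Jet n)) (hΩ : IsOpen Ω)
    (hΩB : ∀ z ∈ Ω, z.trunc 0 (Nat.zero_le n) ∈ B)
    (H : Set (Fin N → ℝ)) (hH : IsOpen H)
    (hHcone : ∀ h ∈ H, ∀ t : ℝ, 0 < t → t • h ∈ H)
    -- the differential equation `F = 0`, of maximal rank
    (F : FDStability.Jet n → ℝ) (hF : ContDiffOn ℝ ∞ F Ω)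
    (hrank : ∀ z ∈ Ω, F z = 0 → fderiv ℝ F z ≠ 0)
    -- the finite-difference approximation and its first differential approximation
    (L : Fin (N + 1) → (Fin (N + 1) → ℝ) → (Fin (N + 1) → ℝ) → ℝ)
    (L1 : Fin (N + 1) → FDStability.Jet p → (Fin N → ℝ) → ℝ)
    (hL1 : ∀ α, ContDiffOn ℝ ∞
      (fun w : FDStability.Jet p × (Fin N → ℝ) => L1 α w.1 w.2)
      {w | w.1.trunc n hnp ∈ Ω ∧ w.2 ∈ H})
    (happrox : FDStability.IsFirstDifferentialApproximation hnp Ω H F L L1)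
    -- the point symmetry `X₀` with `X₀ F = λ F`
    (ξ₀ φ₀ : FDStability.Jet 0 → ℝ) (hξ₀ : ContDiffOn ℝ ∞ ξ₀ B) (hφ₀ : ContDiffOn ℝ ∞ φ₀ B)
    (lam : FDStability.Jet n → ℝ) (hlam : ContDiffOn ℝ ∞ lam Ω)
    (hsym : ∀ z ∈ Ω, FDStability.applyOp ξ₀ φ₀ F z = lam z * F z) :
    FDStability.IsStable hnp hp B Ω H F L1 ξ₀ φ₀ ↔
      ∀ (α : Fin (N + 1)) (z : FDStability.Jet p) (h : Fin N → ℝ),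
        z.trunc n hnp ∈ Ω → h ∈ H → F (z.trunc n hnp) = 0 →
          FDStability.applyOp ξ₀ φ₀ (fun w => L1 α w h) z
            + (FDStability.totalD ξ₀ (z.trunc (0 + 1) hp) - lam (z.trunc n hnp)) * L1 α z h = 0 := by
  open FDStability in
  constructor
  · rintro ⟨ξ₁, φ₁, hξ₁, hφ₁, hinv⟩ α z h hz hh hFz
    -- Stated for all `h ∈ H`, because a single `h` cannot separate `X₁ F` from the sought
    -- expression.
    have hrate : ∀ h ∈ H, applyOp ξ₁ φ₁ F (z.trunc n hnp)
        + (applyOp ξ₀ φ₀ (fun w => L1 α w h) z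
          + (totalD ξ₀ (z.trunc (0 + 1) hp) - lam (z.trunc n hnp)) * L1 α z h) = 0 := by
      intro h hh
      have hnode : ∀ β : Fin (N + 1), nodeJet p (by omega) β (constState z h) = z :=
        fun β => trunc_jetExtend (by omega) z
      have hnode' : ∀ β : Fin (N + 1),
          nodeJet n (by omega) β (constState z h) = z.trunc n hnp :=
        fun β => congrArg (Jet.trunc n hnp) (hnode β)
      have hs : constState z h ∈ stateDomain hnp Ω H :=
        ⟨fun β => (congrArg (· ∈ Ω) (hnode' β)).mpr hz, hh⟩
      have h1 := eqnRate_eq_zero_of_approxInvariant hB hΩ hH hΩB hF hrank hL1 hξ₀ hφ₀ hξ₁ hφ₁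
        hlam hsym α (hinv α) hz hFz hs (hnode' α)
      rw [eqnRate_eq hΩ hH hHcone hL1 happrox α hs (gridA_constState z h), hnode, hnode'] at h1
      exact h1
    have h1 := hrate h hh
    -- Doubling the steps doubles the expression but leaves `X₁ F` unchanged; the difference of the
    -- two identities is the claim.
    have h2 := hrate _ (hHcone h hh 2 two_pos)
    have hL2 : L1 α z ((2 : ℝ) • h) = 2 * L1 α z h :=
      happrox.map_smul hHcone α hz hh two_pos
    have happly : applyOp ξ₀ φ₀ (fun w => L1 α w ((2 : ℝ) • h)) z
        = 2 * applyOp ξ₀ φ₀ (fun w => L1 α w h) z := by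
      have hev : (fun w => L1 α w ((2 : ℝ) • h)) =ᶠ[𝓝 z] (2 : ℝ) • fun w => L1 α w h := by
        filter_upwards [(hΩ.preimage (continuous_trunc hnp)).mem_nhds hz] with w hw
        exact happrox.map_smul hHcone α hw hh two_pos
      rw [applyOp, hev.fderiv_eq, fderiv_const_smul_field]
      rfl
    rw [hL2, happly] at h2
    linear_combination h2 - h1
  · intro hE
    -- No correction of the point operator is needed; `X₁^Δ` still contains `σ₁ = (h² / 2) D² ξ₀`.
    refine ⟨fun _ => 0, fun _ => 0, contDiffOn_const, contDiffOn_const, fun α => ?_⟩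
    refine approxInvariant_of_eqnRate_eq_zero hB hΩ hH hΩB hF hL1 hξ₀ hφ₀ hlam hsym α ?_
    intro s hs hgrid hA
    rw [eqnRate_eq hΩ hH hHcone hL1 happrox α hs hgrid, applyOp, prolong_zero, map_zero, zero_add]
    exact hE α _ _ (hs.1 α) hs.2 hA
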